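/- Let $d\ge 1$, $\mathcal S=\{x\in[0,1]^d:\|x\|_1\le 1\}$ and $\mathrm{Int}(\mathcal S)=\{x\in(0,1)^d:\|x\|_1<1\}$. Let $X_1,X_2,\dots$ be i.i.d. random vectors in $\mathbb R^d$ with c.d.f. $F(y)=\mathbb P(X_1\le y)$ (coordinatewise order), and assume that $F$ is twice continuously differentiable on $\mathcal S$. With the empirical c.d.f. $F_n(y)=\frac1n\sum_{i=1}^n\mathbf 1\{X_i\le y\}$, the Bernstein estimator of $F$ is $$F^\star_{n,m}(x)=\sum_{k\in\mathbb N_0^d,\ \|k\|_1\le m}F_n(k/m)\,\frac{m!}{(m-\|k\|_1)!\prod_i k_i!}\,(1-\|x\|_1)^{m-\|k\|_1}\prod_{i=1}^d x_i^{k_i}.$$ Put $\mathrm{MSE}(F^\star_{n,m}(x))=\mathbb E[(F^\star_{n,m}(x)-F(x))^2]$, $\sigma^2(x)=F(x)(1-F(x))$, $$V(x)=\sum_{i=1}^d \partial_iF(x)\sqrt{\frac{x_i(1-x_i)}{\pi}},\qquad B(x)=\frac12\sum_{i,j=1}^d\big(x_i\mathbf 1_{\{i=j\}}-x_ix_j\big)\,\partial_i\partial_jF(x).$$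 (1) For every integer sequence $m=m(n)\to\infty$ and all $x\in\mathrm{Int}(\mathcal S)$, as $n\to\infty$, $$\mathrm{MSE}(F^\star_{n,m}(x))=n^{-1}\sigma^2(x)-n^{-1}m^{-1/2}V(x)+m^{-2}B^2(x)+\mathrm o_x(n^{-1}m^{-1/2})+\mathrm o(m^{-2}),$$ where the first error term is pointwise in $x$ and the second one is uniform over $x\in\mathrm{Int}(\mathcal S)$. (2) Let $x\in\mathrm{Int}(\mathcal S)$ with $V(x)B(x)\ne0$. Then the asymptotically optimal choice of $m$ with respect to MSE is $$m_{\mathrm{opt}}(x)=n^{2/3}\left[\frac{4B^2(x)}{V(x)}\right]^{2/3}$$ in the following sense. For every $n\ge1$, $m_{\mathrm{opt}}(x)$ is the unique minimizer over real $t>0$ of $n^{-1}\sigma^2(x)-n^{-1}t^{-1/2}V(x)+t^{-2}B^2(x)$. Moreover, a sequence of nonnegative integers $m(n)$ satisfies $m(n)/m_{\mathrm{opt}}(x)\to1$ if and only if $m(n)\to\infty$ and, for every integer sequence $m'(n)\to\infty$ and every $\varepsilon>0$, $\mathrm{MSE}(F^\star_{n,m(n)}(x))\le\mathrm{MSE}(F^\star_{n,m'(n)}(x))+\varepsilon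 n^{-4/3}$ for all large $n$. For every such sequence $m(n)$, as $n\to\infty$, $$\mathrm{MSE}(F^\star_{n,m(n)}(x))=n^{-1}\sigma^2(x)-n^{-4/3}\,\frac34\left[\frac{V^4(x)}{4B^2(x)}\right]^{1/3}+\mathrm o_x(n^{-4/3}).$$ -/

import Mathlib

open Filter Topology Asymptotics MeasureTheory ProbabilityTheory

noncomputable section

namespace BernsteinSimplex

/-- The norm `‖x‖₁ = ∑ |x_i|` on `ℝ^d`. -/
def l1Norm {d : ℕ} (x : Fin d → ℝ) : ℝ := ∑ i, |x i|

/-- The unit simplex `S = {x ∈ [0,1]^d : ‖x‖₁ ≤ 1}`. -/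
def simplex (d : ℕ) : Set (Fin d → ℝ) :=
  {x | (∀ i, x i ∈ Set.Icc (0 : ℝ) 1) ∧ l1Norm x ≤ 1}

/-- Its interior `Int(S) = {x ∈ (0,1)^d : ‖x‖₁ < 1}`. -/
def simplexInterior (d : ℕ) : Set (Fin d → ℝ) :=
  {x | (∀ i, x i ∈ Set.Ioo (0 : ℝ) 1) ∧ l1Norm x < 1}

/-- The joint c.d.f. `F(y) = μ((-∞, y])` of a law `μ` on `ℝ^d` (coordinatewise order). -/
def jointCDF {d : ℕ} (μ : Measure (Fin d → ℝ)) (y : Fin d → ℝ) : ℝ := μ.real (Set.Iic y)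

/-- The index set `{k ∈ ℕ₀^d : k_1 + ⋯ + k_d ≤ m}`, that is, `ℕ₀^d ∩ mS`. -/
def multiIndices (d m : ℕ) : Finset (Fin d → ℕ) :=
  (Fintype.piFinset fun _ => Finset.range (m + 1)).filter fun k => ∑ i, k i ≤ m

/-- The `Multinomial(m, x)` weight `P_{k,m}(x)`. The truncated subtraction `m - ∑ k_i` is exact
for `k ∈ multiIndices d m`. -/
def multinomialWeight {d : ℕ} (m : ℕ) (k : Fin d → ℕ) (x : Fin d → ℝ) : ℝ :=
  (m.factorial : ℝ) / (((m - ∑ i, k i).factorial : ℝ) * ∏ i, ((k i).factorial : ℝ)) *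
    ((1 - l1Norm x) ^ (m - ∑ i, k i) * ∏ i, x i ^ k i)

/-- The Bernstein polynomial of order `m` of a function `G` on the simplex. -/
def bernsteinPoly {d : ℕ} (G : (Fin d → ℝ) → ℝ) (m : ℕ) (x : Fin d → ℝ) : ℝ :=
  ∑ k ∈ multiIndices d m, G (fun i => (k i : ℝ) / (m : ℝ)) * multinomialWeight m k x

/-- The empirical c.d.f. `F_n(y) = n⁻¹ ∑ 1{X_i ≤ y}` of the first `n` observations. -/
def empiricalCDF {d : ℕ} {Ω : Type*} (X : ℕ → Ω → (Fin d → ℝ)) (n : ℕ) (ω : Ω)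
    (y : Fin d → ℝ) : ℝ :=
  (n : ℝ)⁻¹ * ∑ i ∈ Finset.range n, (Set.Iic y).indicator (fun _ => (1 : ℝ)) (X i ω)

/-- The Bernstein estimator `F*_{n,m}(x)`: the Bernstein polynomial of order `m` of `F_n`. -/
def bernsteinEstimator {d : ℕ} {Ω : Type*} (X : ℕ → Ω → (Fin d → ℝ)) (n m : ℕ)
    (x : Fin d → ℝ) (ω : Ω) : ℝ :=
  bernsteinPoly (empiricalCDF X n ω) m x

/-- The mean squared error `E[(F*_{n,m}(x) - F(x))²]`. -/
def mse {d : ℕ} {Ω : Type*} [MeasurableSpace Ω] (P : Measure Ω) (X : ℕ → Ω → (Fin d → ℝ))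
    (F : (Fin d → ℝ) → ℝ) (x : Fin d → ℝ) (n m : ℕ) : ℝ :=
  ∫ ω, (bernsteinEstimator X n m x ω - F x) ^ 2 ∂P

/-- The partial derivative `∂G/∂x_i` at `x`. -/
def partialDeriv {d : ℕ} (i : Fin d) (G : (Fin d → ℝ) → ℝ) (x : Fin d → ℝ) : ℝ :=
  lineDeriv ℝ G x (Pi.single i 1)

/-- `σ²(x) = F(x)(1 - F(x))`. -/
def sigmaSq {d : ℕ} (F : (Fin d → ℝ) → ℝ) (x : Fin d → ℝ) : ℝ := F x * (1 - F x)

/-- `V(x) = ∑ ∂F/∂x_i(x) √(x_i(1 - x_i)/π)`. -/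
def varCoeff {d : ℕ} (F : (Fin d → ℝ) → ℝ) (x : Fin d → ℝ) : ℝ :=
  ∑ i, partialDeriv i F x * Real.sqrt (x i * (1 - x i) / Real.pi)

/-- `B(x) = ½ ∑ (x_i 1{i=j} - x_i x_j) ∂²F/∂x_i∂x_j(x)`. -/
def biasCoeff {d : ℕ} (F : (Fin d → ℝ) → ℝ) (x : Fin d → ℝ) : ℝ :=
  (1 / 2) * ∑ i, ∑ j, ((if i = j then x i else 0) - x i * x j) *
    partialDeriv i (partialDeriv j F) x

/-- The leading part `n⁻¹ σ²(x) - n⁻¹ t^{-1/2} V(x) + t⁻² B(x)²` of the mean squared error,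
for a real bandwidth `t`. -/
def leadingMSE {d : ℕ} (F : (Fin d → ℝ) → ℝ) (x : Fin d → ℝ) (n : ℕ) (t : ℝ) : ℝ :=
  (n : ℝ)⁻¹ * sigmaSq F x - (n : ℝ)⁻¹ * t ^ (-(1 / 2) : ℝ) * varCoeff F x
    + (t ^ 2)⁻¹ * biasCoeff F x ^ 2

/-- `m_opt(x) = n^{2/3} [4 B(x)² / V(x)]^{2/3}`. -/
def mOpt {d : ℕ} (F : (Fin d → ℝ) → ℝ) (x : Fin d → ℝ) (n : ℕ) : ℝ :=
  (n : ℝ) ^ (2 / 3 : ℝ) * (4 * biasCoeff F x ^ 2 / varCoeff F x) ^ (2 / 3 : ℝ)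

/-- A choice `m = m(n) → ∞` of the bandwidth is asymptotically optimal for the risk `R n m`,
up to terms `o(ρ n)`, if no other choice `m' = m'(n) → ∞` has a risk that is smaller by more
than `o(ρ n)`. -/
def IsAsymptoticallyOptimal (R : ℕ → ℕ → ℝ) (ρ : ℕ → ℝ) (m : ℕ → ℕ) : Prop :=
  Tendsto m atTop atTop ∧
    ∀ m' : ℕ → ℕ, Tendsto m' atTop atTop →
      ∀ ε : ℝ, 0 < ε → ∀ᶠ n in atTop, R n (m n) ≤ R n (m' n) + ε * ρ n

end BernsteinSimplex

end

/-! The estimator is linear in `F_n`, hence the average of `n` i.i.d. copies of a kernel `Y`, and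
the MSE is `n⁻¹ Var Y` plus the squared bias. For independent Multinomial(m, x) vectors `K`, `L`,
one has `E Y = E F(K/m)`. Since `1{X ≤ a} 1{X ≤ b} = 1{X ≤ a ∧ b}`, also `E Y² = E F((K ∧ L)/m)`.

Bias: in the second-order Taylor formula at `x` the linear term averages to zero and the multinomial
covariance turns the quadratic term into exactly `B/m`. The remainder is `o(1/m)` uniformly in `x`,
because the second derivative is uniformly continuous on the compact simplex and the fourth central
moments are `O(m²)` (`eventually_abs_bias_le`).

Variance: as `min(k, l) = (k + l - |k - l|)/2`, a first-order expansion gives `E F((K ∧ L)/m) - F =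
-(2m)⁻¹ ∑ ∂_i F · E|K_i - L_i| + O(1/m)`. By the central limit theorem and uniform integrability,
`E|K_i - L_i|/√m` tends to the absolute mean of `N(0, 2x_i(1 - x_i))`, that is `2√(x_i(1 - x_i)/π)`,
which produces `-m^{-1/2} V` (`tendsto_sqrt_mul_infMean_sub`). The bias affects the variance only at
order `1/m`.

Optimal bandwidth: put `s = n^{1/3} m^{-1/2}`. Then `n^{4/3} (MSE - σ²/n) = -V s + B² s⁴ + e₁ s + e₂
s⁴` with `e₁, e₂ → 0` as `m → ∞`. Monotonicity of `F` gives `V ≥ 0`, so `V > 0` in part (2), and the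
quartic has a unique minimizer `s₀` on `s ≥ 0`, where `4 B² s₀³ = V`. Its excess over the minimum
dominates both `(s - s₀)²` and, up to a constant, `s + s⁴`. So the errors are harmless without any a
priori bound on `s`, and near-optimality means `s → s₀`, that is `m/m_opt → 1`. -/

namespace BernsteinSimplex

/-! ### Multinomial expectations as a random walk. -/

section Multinomial

variable {d : ℕ} {E : Type*} [AddCommGroup E] [Module ℝ E]

/-- The expectation of `G(K)` for a `Multinomial(m, x)` vector `K`. -/
noncomputable def multinomialExp (m : ℕ) (x : Fin d → ℝ) (G : (Fin d → ℕ) → E) : E :=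
  ∑ k ∈ multiIndices d m, multinomialWeight m k x • G k

/-- The increments of the multinomial random walk. -/
def step : Option (Fin d) → Fin d → ℕ
  | none => 0
  | some i => Pi.single i 1

/-- The probabilities of the increments of the multinomial random walk. -/
noncomputable def stepWeight (x : Fin d → ℝ) : Option (Fin d) → ℝ
  | none => 1 - l1Norm x
  | some i => x i

theorem mem_multiIndices {m : ℕ} {k : Fin d → ℕ} : k ∈ multiIndices d m ↔ ∑ i, k i ≤ m := by
  simp only [multiIndices, Finset.mem_filter, Fintype.mem_piFinset, Finset.mem_range,
    and_iff_right_iff_imp]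
  intro h i
  exact Nat.lt_succ_of_le ((Finset.single_le_sum (fun _ _ => Nat.zero_le _)
    (Finset.mem_univ i)).trans h)

/-- In the monoid algebra of `ℕ^d` multiplication is convolution, so the multinomial law is the
`m`-th power of the one-step law. The binomial theorem separates the null step, and the multinomial
theorem expands the rest. -/
theorem sum_step_pow (m : ℕ) (x : Fin d → ℝ) :
    (∑ a, AddMonoidAlgebra.single (step a) (stepWeight x a)) ^ m =
      ∑ k ∈ multiIndices d m, AddMonoidAlgebra.single k (multinomialWeight m k x) := by
  have hfib (j : ℕ) (hj : j ∈ Finset.range (m + 1)) :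
      (multiIndices d m).filter (fun k => ∑ i, k i = j) = Finset.univ.piAntidiag j := by
    ext k
    simp only [Finset.mem_filter, mem_multiIndices, Finset.mem_piAntidiag, Finset.mem_univ,
      implies_true, and_true, Finset.mem_range] at hj ⊢
    exact ⟨fun h => h.2, fun h => ⟨h.trans_le (Nat.lt_succ_iff.1 hj), h⟩⟩
  rw [Fintype.sum_option, add_comm, add_pow,
    ← Finset.sum_fiberwise_of_maps_to (s := multiIndices d m) (t := Finset.range (m + 1))
      (g := fun k => ∑ i, k i)
      (fun k hk => Finset.mem_range.2 (Nat.lt_succ_of_le (mem_multiIndices.1 hk)))]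
  refine Finset.sum_congr rfl fun j hj => ?_
  rw [hfib j hj, Finset.sum_pow_eq_sum_piAntidiag, Finset.sum_mul, Finset.sum_mul]
  refine Finset.sum_congr rfl fun k hk => ?_
  have hkj : ∑ i, k i = j := (Finset.mem_piAntidiag.1 hk).1
  have hjm : j ≤ m := Nat.lt_succ_iff.1 (Finset.mem_range.1 hj)
  have hprod : ∏ i, AddMonoidAlgebra.single (step (some i)) (stepWeight x (some i)) ^ k i =
      AddMonoidAlgebra.single k (∏ i, x i ^ k i) := by
    simp only [AddMonoidAlgebra.single_pow, step, stepWeight]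
    rw [AddMonoidAlgebra.prod_single]
    refine congrArg (fun l => AddMonoidAlgebra.single l _) ?_
    ext i
    simp [Finset.sum_apply, Pi.single_apply]
  rw [hprod, AddMonoidAlgebra.single_pow]
  have hN (N : ℕ) : (N : AddMonoidAlgebra ℝ (Fin d → ℕ)) = AddMonoidAlgebra.single 0 (N : ℝ) := by
    rfl
  rw [hN, hN, AddMonoidAlgebra.single_mul_single, AddMonoidAlgebra.single_mul_single,
    AddMonoidAlgebra.single_mul_single]
  simp only [step, smul_zero, zero_add, add_zero, stepWeight]
  congr 1
  have h1 : (Nat.multinomial Finset.univ k : ℝ) = (j.factorial : ℝ) / ∏ i, ((k i).factorial : ℝ) := by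
    rw [eq_div_iff (by positivity), mul_comm, ← hkj]
    exact_mod_cast Nat.multinomial_spec Finset.univ k
  rw [multinomialWeight, hkj, h1, Nat.cast_choose ℝ hjm]
  field_simp

theorem multinomialExp_zero (x : Fin d → ℝ) (G : (Fin d → ℕ) → E) :
    multinomialExp 0 x G = G 0 := by
  have : multiIndices d 0 = {0} := by
    ext k
    simp [mem_multiIndices, funext_iff]
  simp [multinomialExp, this, multinomialWeight]

/-- Conditioning on one step of the walk. All moments and characteristic functions below follow from
it by induction on `m`. -/
theorem multinomialExp_succ (m : ℕ) (x : Fin d → ℝ) (G : (Fin d → ℕ) → E) :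
    multinomialExp (m + 1) x G =
      ∑ a, stepWeight x a • multinomialExp m x (fun k => G (k + step a)) := by
  let L : AddMonoidAlgebra ℝ (Fin d → ℕ) →ₗ[ℝ] E :=
    (Finsupp.linearCombination ℝ G) ∘ₗ (AddMonoidAlgebra.coeffLinearEquiv ℝ).toLinearMap
  have hL (k : Fin d → ℕ) (r : ℝ) : L (AddMonoidAlgebra.single k r) = r • G k := by
    simp [L]
  have h := congrArg L (sum_step_pow (m + 1) x)
  rw [pow_succ, sum_step_pow, Finset.sum_mul_sum, map_sum, map_sum] at h
  simp only [map_sum, AddMonoidAlgebra.single_mul_single, hL] at h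
  rw [multinomialExp, ← h, Finset.sum_comm]
  simp only [multinomialExp, Finset.smul_sum, smul_smul, mul_comm]

theorem multinomialExp_add (m : ℕ) (x : Fin d → ℝ) (G H : (Fin d → ℕ) → E) :
    multinomialExp m x (fun k => G k + H k) = multinomialExp m x G + multinomialExp m x H := by
  simp [multinomialExp, Finset.sum_add_distrib]

theorem multinomialExp_sub (m : ℕ) (x : Fin d → ℝ) (G H : (Fin d → ℕ) → E) :
    multinomialExp m x (fun k => G k - H k) = multinomialExp m x G - multinomialExp m x H := by
  simp [multinomialExp, smul_sub, Finset.sum_sub_distrib]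

theorem multinomialExp_sum {ι : Type*} (s : Finset ι) (m : ℕ) (x : Fin d → ℝ)
    (G : ι → (Fin d → ℕ) → E) :
    multinomialExp m x (fun k => ∑ i ∈ s, G i k) = ∑ i ∈ s, multinomialExp m x (G i) := by
  simp only [multinomialExp, Finset.smul_sum]
  exact Finset.sum_comm

theorem multinomialExp_linearMap {E' : Type*} [AddCommGroup E'] [Module ℝ E'] (L : E →ₗ[ℝ] E')
    (m : ℕ) (x : Fin d → ℝ) (G : (Fin d → ℕ) → E) :
    multinomialExp m x (fun k => L (G k)) = L (multinomialExp m x G) := by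
  simp [multinomialExp]

theorem multinomialExp_const_mul (m : ℕ) (x : Fin d → ℝ) (c : ℝ) (G : (Fin d → ℕ) → ℝ) :
    multinomialExp m x (fun k => c * G k) = c * multinomialExp m x G :=
  multinomialExp_linearMap (LinearMap.mulLeft ℝ c) m x G

end Multinomial

/-! ### Positivity and central moments of the multinomial law. -/

section Nonneg

variable {d : ℕ} {x : Fin d → ℝ}

theorem l1Norm_eq_sum (hx : ∀ i, 0 ≤ x i) : l1Norm x = ∑ i, x i :=
  Finset.sum_congr rfl fun i _ => abs_of_nonneg (hx i)

theorem sum_stepWeight (hx : ∀ i, 0 ≤ x i) : ∑ a, stepWeight x a = 1 := by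
  simp [Fintype.sum_option, stepWeight, l1Norm_eq_sum hx]

theorem multinomialExp_const {E : Type*} [AddCommGroup E] [Module ℝ E] (hx : ∀ i, 0 ≤ x i)
    (m : ℕ) (c : E) : multinomialExp m x (fun _ => c) = c := by
  induction m with
  | zero => rw [multinomialExp_zero]
  | succ m ih => simp only [multinomialExp_succ, ih, ← Finset.sum_smul, sum_stepWeight hx, one_smul]

theorem multinomialWeight_nonneg (hx : ∀ i, 0 ≤ x i) (hx1 : l1Norm x ≤ 1) (m : ℕ)
    (k : Fin d → ℕ) : 0 ≤ multinomialWeight m k x := by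
  have h1 : 0 ≤ 1 - l1Norm x := sub_nonneg.2 hx1
  have h2 : 0 ≤ ∏ i, x i ^ k i := Finset.prod_nonneg fun i _ => pow_nonneg (hx i) _
  unfold multinomialWeight
  positivity

theorem multinomialExp_mono (hx : ∀ i, 0 ≤ x i) (hx1 : l1Norm x ≤ 1) {m : ℕ}
    {G H : (Fin d → ℕ) → ℝ} (h : ∀ k, ∑ i, k i ≤ m → G k ≤ H k) :
    multinomialExp m x G ≤ multinomialExp m x H :=
  Finset.sum_le_sum fun k hk => mul_le_mul_of_nonneg_left (h k (mem_multiIndices.1 hk))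
    (multinomialWeight_nonneg hx hx1 m k)

theorem abs_multinomialExp_le (hx : ∀ i, 0 ≤ x i) (hx1 : l1Norm x ≤ 1) {m : ℕ}
    {G H : (Fin d → ℕ) → ℝ} (h : ∀ k, ∑ i, k i ≤ m → |G k| ≤ H k) :
    |multinomialExp m x G| ≤ multinomialExp m x H := by
  rw [abs_le]
  refine ⟨?_, multinomialExp_mono hx hx1 fun k hk => (abs_le.1 (h k hk)).2⟩
  have := multinomialExp_mono hx hx1 (G := fun k => -1 * H k) (H := G) (m := m) fun k hk => by
    linarith [(abs_le.1 (h k hk)).1]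
  rw [multinomialExp_const_mul] at this
  linarith

/-- The centered coordinates of the multinomial random walk. -/
def centered (x : Fin d → ℝ) (m : ℕ) (i : Fin d) (k : Fin d → ℕ) : ℝ := k i - m * x i

theorem centered_step (m : ℕ) (i : Fin d) (k : Fin d → ℕ) (a : Option (Fin d)) :
    centered x (m + 1) i (k + step a) = centered x m i k + (step a i - x i) := by
  simp only [centered, Pi.add_apply]
  push_cast
  ring

theorem sum_stepWeight_mul_step (i : Fin d) :
    ∑ a, stepWeight x a * (step a i : ℝ) = x i := by
  simp [Fintype.sum_option, stepWeight, step, Pi.single_apply]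

theorem sum_stepWeight_mul_step_mul_step (i j : Fin d) :
    ∑ a, stepWeight x a * ((step a i : ℝ) * step a j) = if i = j then x i else 0 := by
  simp only [Fintype.sum_option, stepWeight, step, Pi.single_apply, Pi.zero_apply]
  by_cases h : i = j
  · simp [h]
  · simp [h]

theorem sum_stepWeight_centered (hx : ∀ i, 0 ≤ x i) (i : Fin d) :
    ∑ a, stepWeight x a * ((step a i : ℝ) - x i) = 0 := by
  simp only [mul_sub, Finset.sum_sub_distrib, sum_stepWeight_mul_step, ← Finset.sum_mul,
    sum_stepWeight hx]
  ring

theorem sum_stepWeight_centered_mul (hx : ∀ i, 0 ≤ x i) (i j : Fin d) :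
    ∑ a, stepWeight x a * (((step a i : ℝ) - x i) * ((step a j : ℝ) - x j)) =
      (if i = j then x i else 0) - x i * x j := by
  have h : ∀ a, stepWeight x a * (((step a i : ℝ) - x i) * ((step a j : ℝ) - x j)) =
      stepWeight x a * ((step a i : ℝ) * step a j) - (stepWeight x a * (step a i : ℝ)) * x j
      - (stepWeight x a * (step a j : ℝ)) * x i + stepWeight x a * (x i * x j) := fun a => by ring
  simp only [h, Finset.sum_add_distrib, Finset.sum_sub_distrib, ← Finset.sum_mul,
    sum_stepWeight_mul_step, sum_stepWeight_mul_step_mul_step, sum_stepWeight hx]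
  ring

theorem multinomialExp_centered (hx : ∀ i, 0 ≤ x i) (m : ℕ) (i : Fin d) :
    multinomialExp m x (centered x m i) = 0 := by
  induction m with
  | zero => simp [multinomialExp_zero, centered]
  | succ m ih =>
    simp only [multinomialExp_succ, centered_step, multinomialExp_add, multinomialExp_const hx,
      smul_eq_mul]
    simp only [mul_add, Finset.sum_add_distrib, sum_stepWeight_centered hx]
    rw [show multinomialExp m x (fun k => centered x m i k) = 0 from ih]
    simp

theorem multinomialExp_centered_mul (hx : ∀ i, 0 ≤ x i) (m : ℕ) (i j : Fin d) :
    multinomialExp m x (fun k => centered x m i k * centered x m j k) =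
      m * ((if i = j then x i else 0) - x i * x j) := by
  induction m with
  | zero => simp [multinomialExp_zero, centered]
  | succ m ih =>
    have h (a : Option (Fin d)) : multinomialExp m x (fun k =>
        centered x (m + 1) i (k + step a) * centered x (m + 1) j (k + step a)) =
        m * ((if i = j then x i else 0) - x i * x j) +
          ((step a i : ℝ) - x i) * ((step a j : ℝ) - x j) := by
      have h1 := multinomialExp_centered hx m i
      have h2 := multinomialExp_centered hx m j
      rw [← ih]
      calc _ = multinomialExp m x (fun k => centered x m i k * centered x m j k +
            (((step a j : ℝ) - x j) * centered x m i k + ((step a i : ℝ) - x i) * centered x m j k +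
            ((step a i : ℝ) - x i) * ((step a j : ℝ) - x j))) := by
            congr 1; ext k; rw [centered_step, centered_step]; ring
        _ = _ := by
            rw [multinomialExp_add, multinomialExp_add, multinomialExp_add,
              multinomialExp_const_mul, multinomialExp_const_mul, h1, h2, multinomialExp_const hx]
            ring
    simp only [multinomialExp_succ, h, smul_eq_mul, mul_add, Finset.sum_add_distrib,
      sum_stepWeight_centered_mul hx]
    rw [← Finset.sum_mul, sum_stepWeight hx]
    push_cast
    ring

theorem stepWeight_nonneg (hx : ∀ i, 0 ≤ x i) (hx1 : l1Norm x ≤ 1) (a : Option (Fin d)) :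
    0 ≤ stepWeight x a := by
  cases a with
  | none => exact sub_nonneg.2 hx1
  | some i => exact hx i

theorem le_one_of_l1Norm_le (hx1 : l1Norm x ≤ 1) (i : Fin d) : x i ≤ 1 :=
  (le_abs_self _).trans ((Finset.single_le_sum (f := fun j => |x j|) (fun _ _ => abs_nonneg _)
    (Finset.mem_univ i)).trans hx1)

theorem multinomialExp_centered_sq_le (hx : ∀ i, 0 ≤ x i) (m : ℕ) (i : Fin d) :
    multinomialExp m x (fun k => centered x m i k ^ 2) ≤ m / 4 := by
  simp only [sq, multinomialExp_centered_mul hx, if_true]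
  nlinarith [sq_nonneg (x i - 1 / 2), (Nat.cast_nonneg m : (0 : ℝ) ≤ m)]

/-- Expand `(S + u)⁴` for the walk `S` and a new centered step `u`. The `S³u` term vanishes on
averaging over `u`, the `Su³` term on averaging over `S`, and `|u| ≤ 1` leaves an increment of at
most `6m/4 + 1`, below `3(m+1)² - 3m²`. -/
theorem multinomialExp_centered_pow_four_le (hx : ∀ i, 0 ≤ x i) (hx1 : l1Norm x ≤ 1) (m : ℕ)
    (i : Fin d) : multinomialExp m x (fun k => centered x m i k ^ 4) ≤ 3 * (m : ℝ) ^ 2 := by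
  induction m with
  | zero => simp [multinomialExp_zero, centered]
  | succ m ih =>
    have hu (a : Option (Fin d)) : ((step a i : ℝ) - x i) ^ 2 ≤ 1 := by
      have h0 := hx i
      have h1 := le_one_of_l1Norm_le hx1 i
      have h2 : (step a i : ℝ) = 0 ∨ (step a i : ℝ) = 1 := by
        cases a with
        | none => simp [step]
        | some j => by_cases hj : i = j <;> simp [step, hj]
      rcases h2 with h2 | h2 <;> rw [h2] <;> nlinarith
    have h2 := multinomialExp_centered_sq_le hx m i
    have hs := multinomialExp_centered hx m i
    have h20 : 0 ≤ multinomialExp m x (fun k => centered x m i k ^ 2) := by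
      rw [← multinomialExp_const hx m (0 : ℝ)]
      exact multinomialExp_mono hx hx1 fun k _ => sq_nonneg _
    have h (a : Option (Fin d)) : multinomialExp m x (fun k =>
        centered x (m + 1) i (k + step a) ^ 4) ≤ 3 * (m : ℝ) ^ 2 + (6 * (m / 4) + 1) +
        4 * multinomialExp m x (fun k => centered x m i k ^ 3) * ((step a i : ℝ) - x i) := by
      set u := (step a i : ℝ) - x i with hu'
      calc _ = multinomialExp m x (fun k => centered x m i k ^ 4 +
            (4 * u * centered x m i k ^ 3 + (6 * u ^ 2 * centered x m i k ^ 2 +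
            (4 * u ^ 3 * centered x m i k + u ^ 4)))) := by
            congr 1; ext k; rw [centered_step]; ring
        _ = multinomialExp m x (fun k => centered x m i k ^ 4) +
            (4 * u * multinomialExp m x (fun k => centered x m i k ^ 3) +
            (6 * u ^ 2 * multinomialExp m x (fun k => centered x m i k ^ 2) +
            u ^ 4)) := by
            rw [multinomialExp_add, multinomialExp_add, multinomialExp_add, multinomialExp_add,
              multinomialExp_const_mul, multinomialExp_const_mul, multinomialExp_const_mul, hs,
              multinomialExp_const hx]
            ring
        _ ≤ _ := by
            have := hu a
            have h4 : u ^ 4 ≤ 1 := by nlinarith [sq_nonneg u]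
            have h5 : u ^ 2 * multinomialExp m x (fun k => centered x m i k ^ 2) ≤ m / 4 := by
              nlinarith [sq_nonneg u]
            nlinarith
    rw [multinomialExp_succ]
    calc _ ≤ ∑ a, stepWeight x a * (3 * (m : ℝ) ^ 2 + (6 * (m / 4) + 1) +
        4 * multinomialExp m x (fun k => centered x m i k ^ 3) * ((step a i : ℝ) - x i)) :=
          Finset.sum_le_sum fun a _ =>
            mul_le_mul_of_nonneg_left (h a) (stepWeight_nonneg hx hx1 a)
      _ = 3 * (m : ℝ) ^ 2 + (6 * (m / 4) + 1) := by
          have h3 (a : Option (Fin d)) (c e : ℝ) : stepWeight x a * (c + e * ((step a i : ℝ) - x i))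
              = stepWeight x a * c + e * (stepWeight x a * ((step a i : ℝ) - x i)) := by ring
          simp only [h3, Finset.sum_add_distrib, ← Finset.mul_sum, sum_stepWeight_centered hx]
          rw [← Finset.sum_mul, sum_stepWeight hx]
          ring
      _ ≤ _ := by push_cast; nlinarith [(Nat.cast_nonneg m : (0 : ℝ) ≤ m)]

end Nonneg

/-! ### Finitely supported laws on the line. -/

section FiniteLaw

variable {ι : Type*}

/-- The law of `f` under the weights `w` on the finite set `s`. -/
noncomputable def finiteLaw (s : Finset ι) (w f : ι → ℝ) : Measure ℝ :=
  ∑ i ∈ s, ENNReal.ofReal (w i) • Measure.dirac (f i)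

theorem integrable_finiteLaw {E : Type*} [NormedAddCommGroup E] [NormedSpace ℝ E]
    (s : Finset ι) (w f : ι → ℝ) (g : ℝ → E) : Integrable g (finiteLaw s w f) :=
  integrable_finsetSum_measure.2 fun _ _ =>
    (integrable_dirac (by simp)).smul_measure ENNReal.ofReal_ne_top

theorem integral_finiteLaw {E : Type*} [NormedAddCommGroup E] [NormedSpace ℝ E] [CompleteSpace E]
    {s : Finset ι} {w : ι → ℝ} (hw : ∀ i ∈ s, 0 ≤ w i) (f : ι → ℝ) (g : ℝ → E) :
    ∫ y, g y ∂(finiteLaw s w f) = ∑ i ∈ s, w i • g (f i) := by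
  rw [finiteLaw, integral_finsetSum_measure fun _ _ =>
    (integrable_dirac (by simp)).smul_measure ENNReal.ofReal_ne_top]
  refine Finset.sum_congr rfl fun i hi => ?_
  rw [integral_smul_measure, integral_dirac, ENNReal.toReal_ofReal (hw i hi)]

theorem isProbabilityMeasure_finiteLaw {s : Finset ι} {w : ι → ℝ} (hw : ∀ i ∈ s, 0 ≤ w i)
    (f : ι → ℝ) (h1 : ∑ i ∈ s, w i = 1) : IsProbabilityMeasure (finiteLaw s w f) := by
  refine ⟨?_⟩
  simp only [finiteLaw, Measure.coe_finsetSum, Finset.sum_apply, Measure.smul_apply,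
    measure_univ, smul_eq_mul, mul_one]
  rw [← ENNReal.ofReal_sum_of_nonneg hw, h1, ENNReal.ofReal_one]

end FiniteLaw

/-! ### Convergence of absolute means, and the Gaussian absolute mean. -/

section UniformIntegrability

/-- The truncation error satisfies `|y| - min |y| M ≤ y²/M` pointwise. -/
theorem abs_integral_abs_sub_min_le {μ : Measure ℝ} [IsProbabilityMeasure μ] {C M : ℝ} (hM : 0 < M)
    (h2 : Integrable (fun y => y ^ 2) μ) (hC : ∫ y, y ^ 2 ∂μ ≤ C) :
    |∫ y, |y| ∂μ - ∫ y, min |y| M ∂μ| ≤ C / M := by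
  have h1 : Integrable (fun y : ℝ => |y|) μ := by
    refine Integrable.mono' (h2.add (integrable_const 1)) (by fun_prop) (.of_forall fun y => ?_)
    simp only [Real.norm_eq_abs, abs_abs, Pi.add_apply]
    nlinarith [sq_nonneg (|y| - 1), sq_abs y, abs_nonneg y]
  have hm : Integrable (fun y : ℝ => min |y| M) μ := h1.inf (integrable_const M)
  rw [← integral_sub h1 hm, abs_of_nonneg (integral_nonneg fun y => by simp)]
  calc _ ≤ ∫ y, y ^ 2 / M ∂μ := by
        refine integral_mono (h1.sub hm) (h2.div_const M) fun y => ?_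
        rw [le_div_iff₀ hM, ← sq_abs]
        rcases le_total |y| M with h | h
        · simp [h, sq_nonneg]
        · simp only [h, min_eq_right]
          nlinarith [sq_nonneg (|y| - M), abs_nonneg y]
    _ ≤ _ := by rw [integral_div]; gcongr

/-- Weak convergence handles the bounded function `min |y| M`; the common second-moment bound makes
the truncation errors uniformly small. -/
theorem tendsto_integral_abs {μ : ℕ → ProbabilityMeasure ℝ} {ν : ProbabilityMeasure ℝ}
    (h : Tendsto μ atTop (𝓝 ν)) {C : ℝ}
    (hμ : ∀ n, Integrable (fun y => y ^ 2) (μ n : Measure ℝ))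
    (hν : Integrable (fun y => y ^ 2) (ν : Measure ℝ))
    (hμC : ∀ n, ∫ y, y ^ 2 ∂(μ n : Measure ℝ) ≤ C) (hνC : ∫ y, y ^ 2 ∂(ν : Measure ℝ) ≤ C) :
    Tendsto (fun n => ∫ y, |y| ∂(μ n : Measure ℝ)) atTop (𝓝 (∫ y, |y| ∂(ν : Measure ℝ))) := by
  rw [Metric.tendsto_nhds]
  intro ε hε
  have hC0 : 0 ≤ C := (integral_nonneg fun y => sq_nonneg y).trans hνC
  set M := 3 * (C + 1) / ε with hM
  have hM0 : 0 < M := by positivity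
  have hCM : C / M < ε / 3 := by
    rw [hM, div_lt_iff₀ (by positivity)]
    field_simp
    linarith
  let f : BoundedContinuousFunction ℝ ℝ := BoundedContinuousFunction.ofNormedAddCommGroup
    (fun y => min |y| M) (by fun_prop) M (fun y => by
      rw [Real.norm_eq_abs, abs_of_nonneg (le_min (abs_nonneg y) hM0.le)]
      exact min_le_right _ _)
  have hf := (ProbabilityMeasure.tendsto_iff_forall_integral_tendsto.1 h) f
  filter_upwards [Metric.tendsto_nhds.1 hf (ε / 3) (by positivity)] with n hn
  have a1 := abs_integral_abs_sub_min_le hM0 (hμ n) (hμC n)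
  have a2 := abs_integral_abs_sub_min_le hM0 hν hνC
  simp only [f, BoundedContinuousFunction.coe_ofNormedAddCommGroup] at hn
  rw [Real.dist_eq, abs_lt] at hn ⊢
  rw [abs_le] at a1 a2
  constructor <;> linarith

theorem integral_abs_gaussianReal {v : NNReal} (hv : v ≠ 0) :
    ∫ y, |y| ∂(gaussianReal 0 v) = Real.sqrt (2 * v / Real.pi) := by
  have hv0 : (0 : ℝ) < v := by positivity
  have hpi := Real.pi_pos
  rw [integral_gaussianReal_eq_integral_smul hv]
  have h1 : ∀ y : ℝ, gaussianPDFReal 0 v y • |y| =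
      (Real.sqrt (2 * Real.pi * v))⁻¹ * (fun z : ℝ => z * Real.exp (-(2 * v : ℝ)⁻¹ * z ^ 2)) |y| := by
    intro y
    simp only [gaussianPDFReal, smul_eq_mul, sub_zero, sq_abs]
    rw [show -y ^ 2 / (2 * (v : ℝ)) = -(2 * v : ℝ)⁻¹ * y ^ 2 by ring]
    ring
  simp only [h1]
  rw [integral_const_mul, integral_comp_abs (f := fun z : ℝ => z * Real.exp (-(2 * v : ℝ)⁻¹ * z ^ 2))]
  have h2 := _root_.integral_rpow_mul_exp_neg_mul_rpow (p := 2) (q := 1) (b := (2 * v : ℝ)⁻¹)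
    (by norm_num) (by norm_num) (by positivity)
  have h3 : ∫ z in Set.Ioi (0 : ℝ), z * Real.exp (-(2 * v : ℝ)⁻¹ * z ^ 2) = v := by
    simp only [Real.rpow_one] at h2
    rw [show ((1 : ℝ) + 1) / 2 = 1 by norm_num, Real.Gamma_one,
      show (-(1 + 1) / 2 : ℝ) = -1 by norm_num, Real.rpow_neg_one] at h2
    norm_num at h2 ⊢
    rw [h2]
    ring
  rw [h3, eq_comm, Real.sqrt_eq_iff_mul_self_eq (by positivity) (by positivity)]
  have h4 := Real.mul_self_sqrt (show (0 : ℝ) ≤ 2 * Real.pi * v by positivity)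
  have h5 : Real.sqrt (2 * Real.pi * v) ≠ 0 := by positivity
  generalize Real.sqrt (2 * Real.pi * v) = w at h4 h5
  field_simp
  linarith

end UniformIntegrability

/-! ### Central limit theorem for the difference of two multinomial coordinates. -/

section MeanDifference

variable {d : ℕ} {x : Fin d → ℝ}

/-- The law of `(K_i - L_i) / √m` for independent `Multinomial(m, x)` vectors `K` and `L`. -/
noncomputable def differenceLaw (m : ℕ) (x : Fin d → ℝ) (i : Fin d) : Measure ℝ :=
  finiteLaw (multiIndices d m ×ˢ multiIndices d m)
    (fun q => multinomialWeight m q.1 x * multinomialWeight m q.2 x)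
    (fun q => (Real.sqrt m)⁻¹ * ((q.1 i : ℝ) - q.2 i))

theorem integral_differenceLaw {E : Type*} [NormedAddCommGroup E] [NormedSpace ℝ E]
    [CompleteSpace E] (hx : ∀ i, 0 ≤ x i) (hx1 : l1Norm x ≤ 1) (m : ℕ) (i : Fin d) (g : ℝ → E) :
    ∫ y, g y ∂(differenceLaw m x i) = multinomialExp m x (fun k => multinomialExp m x (fun l =>
      g ((Real.sqrt m)⁻¹ * ((k i : ℝ) - l i)))) := by
  rw [differenceLaw, integral_finiteLaw fun q _ => mul_nonneg (multinomialWeight_nonneg hx hx1 m _)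
    (multinomialWeight_nonneg hx hx1 m _), Finset.sum_product]
  simp only [multinomialExp, Finset.smul_sum, smul_smul]

theorem isProbabilityMeasure_differenceLaw (hx : ∀ i, 0 ≤ x i) (hx1 : l1Norm x ≤ 1) (m : ℕ)
    (i : Fin d) : IsProbabilityMeasure (differenceLaw m x i) := by
  refine isProbabilityMeasure_finiteLaw (fun q _ => mul_nonneg (multinomialWeight_nonneg hx hx1 m _)
    (multinomialWeight_nonneg hx hx1 m _)) _ ?_
  have h := multinomialExp_const hx m (1 : ℝ)
  simp only [multinomialExp, smul_eq_mul, mul_one] at h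
  rw [Finset.sum_product]
  simp only [← Finset.mul_sum, h, mul_one]

/-- A single coordinate is Binomial(m, x_i): each step adds 0 or 1 to it, which makes `exp (s *
step)` affine in the step. -/
theorem multinomialExp_cexp (hx : ∀ i, 0 ≤ x i) (m : ℕ) (i : Fin d) (s : ℂ) :
    multinomialExp m x (fun k => Complex.exp (s * k i)) = (1 - x i + x i * Complex.exp s) ^ m := by
  induction m with
  | zero => simp [multinomialExp_zero]
  | succ m ih =>
    have h (a : Option (Fin d)) : multinomialExp m x (fun k => Complex.exp (s * (k + step a) i)) =
        (1 - x i + x i * Complex.exp s) ^ m * Complex.exp (s * step a i) := by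
      rw [← ih]
      calc _ = multinomialExp m x (fun k => LinearMap.mulRight ℝ (Complex.exp (s * step a i))
            (Complex.exp (s * k i))) := by
            congr 1; ext k
            simp [mul_add, Complex.exp_add]
        _ = _ := by rw [multinomialExp_linearMap]; rfl
    have h2 (a : Option (Fin d)) : Complex.exp (s * step a i) =
        1 + (step a i : ℂ) * (Complex.exp s - 1) := by
      cases a with
      | none => simp [step]
      | some j => by_cases hj : i = j <;> simp [step, hj]
    rw [multinomialExp_succ]
    simp only [h, h2, Complex.real_smul]
    have h3 : ∀ a, (stepWeight x a : ℂ) * ((1 - x i + x i * Complex.exp s) ^ m *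
        (1 + (step a i : ℂ) * (Complex.exp s - 1))) = (1 - x i + x i * Complex.exp s) ^ m *
        ((stepWeight x a : ℝ) + ((stepWeight x a * (step a i : ℝ) : ℝ) : ℂ) *
          (Complex.exp s - 1)) := fun a => by
      push_cast; ring
    simp only [h3]
    rw [← Finset.mul_sum, Finset.sum_add_distrib, ← Finset.sum_mul, ← Complex.ofReal_sum,
      ← Complex.ofReal_sum, sum_stepWeight hx, sum_stepWeight_mul_step]
    push_cast
    ring

/-- The difference is symmetric, so its characteristic function is real, and the limit reduces to
the real one of `(1 + a_m)^m` with `m a_m` convergent. -/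
theorem charFun_differenceLaw (hx : ∀ i, 0 ≤ x i) (hx1 : l1Norm x ≤ 1) (m : ℕ) (i : Fin d)
    (t : ℝ) : charFun (differenceLaw m x i) t =
      (((1 + -(2 * (x i * (1 - x i)) * (1 - Real.cos (t / Real.sqrt m)))) ^ m : ℝ) : ℂ) := by
  set s : ℂ := (t / Real.sqrt m : ℝ) * Complex.I with hs
  have h (k l : Fin d → ℕ) : Complex.exp (t * (((Real.sqrt m)⁻¹ * ((k i : ℝ) - l i) : ℝ) : ℂ) *
      Complex.I) = Complex.exp (s * k i) * Complex.exp (-s * l i) := by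
    rw [← Complex.exp_add]
    congr 1
    rw [hs]
    push_cast
    ring
  rw [charFun_apply_real, integral_differenceLaw hx hx1]
  simp only [h]
  have h1 (k : Fin d → ℕ) : multinomialExp m x (fun l => Complex.exp (s * k i) *
      Complex.exp (-s * l i)) = Complex.exp (s * k i) * (1 - x i + x i * Complex.exp (-s)) ^ m := by
    rw [← multinomialExp_cexp hx m i (-s)]
    exact multinomialExp_linearMap (LinearMap.mulLeft ℝ (Complex.exp (s * k i))) m x _
  simp only [h1]
  have h2 : multinomialExp m x (fun k => Complex.exp (s * k i) *
      (1 - x i + x i * Complex.exp (-s)) ^ m) =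
      (1 - x i + x i * Complex.exp s) ^ m * (1 - x i + x i * Complex.exp (-s)) ^ m := by
    rw [← multinomialExp_cexp hx m i s]
    exact multinomialExp_linearMap
      (LinearMap.mulRight ℝ ((1 - x i + x i * Complex.exp (-s)) ^ m)) m x _
  rw [h2, ← mul_pow, Complex.ofReal_pow]
  congr 1
  have h3 : Complex.exp s * Complex.exp (-s) = 1 := by rw [← Complex.exp_add]; simp
  have h4 : Complex.exp s + Complex.exp (-s) = 2 * Complex.cos (t / Real.sqrt m : ℝ) := by
    rw [Complex.cos, hs]
    ring_nf
  push_cast at h4 ⊢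
  linear_combination (x i : ℂ) * (1 - x i) * h4 + (x i : ℂ) ^ 2 * h3

/-- Write `1 - cos θ = 2 sin²(θ/2)`; the limit is then the squared derivative at 0 of `h ↦ sin (t h
/ 2)`, taken along `h = 1/√m`. -/
theorem tendsto_mul_one_sub_cos (t : ℝ) :
    Tendsto (fun m : ℕ => (m : ℝ) * (1 - Real.cos (t / Real.sqrt m))) atTop (𝓝 (t ^ 2 / 2)) := by
  have h1 : HasDerivAt (fun h : ℝ => Real.sin (t / 2 * h)) (t / 2) 0 := by
    have := ((hasDerivAt_id (0 : ℝ)).const_mul (t / 2)).sin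
    simpa using this
  have h2 : Tendsto (fun m : ℕ => (Real.sqrt m)⁻¹) atTop (𝓝[≠] 0) := by
    refine tendsto_nhdsWithin_iff.2 ⟨tendsto_inv_atTop_zero.comp
      (Real.tendsto_sqrt_atTop.comp tendsto_natCast_atTop_atTop), ?_⟩
    filter_upwards [eventually_gt_atTop 0] with m hm
    have : (0 : ℝ) < m := by exact_mod_cast hm
    simp only [Set.mem_compl_iff, Set.mem_singleton_iff]
    positivity
  have h3 := ((hasDerivAt_iff_tendsto_slope_zero.1 h1).comp h2).pow 2 |>.const_mul 2
  rw [show t ^ 2 / 2 = 2 * (t / 2) ^ 2 by ring]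
  refine h3.congr fun m => ?_
  simp only [Function.comp, zero_add, mul_zero, Real.sin_zero, sub_zero, smul_eq_mul, inv_inv]
  rw [mul_pow, Real.sq_sqrt (Nat.cast_nonneg m), Real.sin_sq_eq_half_sub]
  rw [show 2 * (t / 2 * (Real.sqrt m)⁻¹) = t / Real.sqrt m by ring]
  ring

/-- The central limit theorem for the difference of two independent multinomial vectors, in mean. -/
theorem tendsto_multinomialExp_abs_sub (hx : ∀ i, 0 < x i) (hx1 : l1Norm x ≤ 1) (i : Fin d)
    (hxi : x i < 1) :
    Tendsto (fun m : ℕ => (Real.sqrt m)⁻¹ * multinomialExp m x (fun k => multinomialExp m x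
      (fun l => |(k i : ℝ) - l i|))) atTop
      (𝓝 (2 * Real.sqrt (x i * (1 - x i) / Real.pi))) := by
  have hx' := fun i => (hx i).le
  have hr : 0 < x i * (1 - x i) := mul_pos (hx i) (sub_pos.2 hxi)
  -- Twice the variance of one Bernoulli step, since two independent walks are subtracted.
  set v : NNReal := ⟨2 * (x i * (1 - x i)), by positivity⟩ with hv
  have hvr : (v : ℝ) = 2 * (x i * (1 - x i)) := rfl
  have hv0 : v ≠ 0 := by
    rw [Ne, ← NNReal.coe_eq_zero, hvr]
    positivity
  let μ (m : ℕ) : ProbabilityMeasure ℝ :=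
    ⟨differenceLaw m x i, isProbabilityMeasure_differenceLaw hx' hx1 m i⟩
  let ν : ProbabilityMeasure ℝ := ⟨gaussianReal 0 v, inferInstance⟩
  have hlim : Tendsto μ atTop (𝓝 ν) := by
    refine ProbabilityMeasure.tendsto_iff_tendsto_charFun.2 fun t => ?_
    change Tendsto (fun m => charFun (differenceLaw m x i) t) atTop
      (𝓝 (charFun (gaussianReal 0 v) t))
    rw [charFun_gaussianReal]
    simp only [charFun_differenceLaw hx' hx1]
    have h1 : Tendsto (fun m : ℕ => (m : ℝ) * -(2 * (x i * (1 - x i)) *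
        (1 - Real.cos (t / Real.sqrt m)))) atTop (𝓝 (-(v * t ^ 2 / 2))) := by
      rw [show -(v * t ^ 2 / 2 : ℝ) = -v * (t ^ 2 / 2) by ring]
      refine ((tendsto_mul_one_sub_cos t).const_mul (-(v : ℝ))).congr fun m => ?_
      rw [hvr]
      ring
    have h2 := (Complex.continuous_ofReal.tendsto _).comp
      (Real.tendsto_one_add_pow_exp_of_tendsto h1)
    convert h2 using 2
    · rfl
    rw [Complex.ofReal_exp]
    congr 1
    push_cast
    ring
  have hsq (m : ℕ) : ∫ y, y ^ 2 ∂(differenceLaw m x i) ≤ 2 := by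
    rw [integral_differenceLaw hx' hx1]
    rcases Nat.eq_zero_or_pos m with rfl | hm
    · simp [multinomialExp_zero]
    have hm0 : (0 : ℝ) < m := by exact_mod_cast hm
    have h (k l : Fin d → ℕ) : ((Real.sqrt m)⁻¹ * ((k i : ℝ) - l i)) ^ 2 ≤
        (2 * (m : ℝ)⁻¹) * centered x m i k ^ 2 + (2 * (m : ℝ)⁻¹) * centered x m i l ^ 2 := by
      rw [mul_pow, inv_pow, Real.sq_sqrt hm0.le, mul_assoc, mul_assoc, mul_left_comm,
        mul_left_comm 2, ← mul_add]
      gcongr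
      simp only [centered]
      nlinarith [sq_nonneg ((k i - m * x i) + (l i - m * x i))]
    have hc := multinomialExp_centered_sq_le hx' m i
    calc _ ≤ multinomialExp m x (fun k => multinomialExp m x (fun l =>
          (2 * (m : ℝ)⁻¹) * centered x m i k ^ 2 + (2 * (m : ℝ)⁻¹) * centered x m i l ^ 2)) :=
          multinomialExp_mono hx' hx1 fun k _ => multinomialExp_mono hx' hx1 fun l _ => h k l
      _ = 4 * (m : ℝ)⁻¹ * multinomialExp m x (fun k => centered x m i k ^ 2) := by
          simp only [multinomialExp_add, multinomialExp_const hx', multinomialExp_const_mul]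
          ring
      _ ≤ 4 * (m : ℝ)⁻¹ * (m / 4) := by gcongr
      _ ≤ 2 := by field_simp; norm_num
  have hν2 : Integrable (fun y : ℝ => y ^ 2) (gaussianReal 0 v) :=
    (memLp_id_gaussianReal (μ := 0) (v := v) 2).integrable_sq
  have hνC : ∫ y, y ^ 2 ∂(gaussianReal 0 v) ≤ 2 := by
    have h1 := variance_id_gaussianReal (μ := 0) (v := v)
    rw [variance_eq_integral aemeasurable_id] at h1
    simp only [id, integral_id_gaussianReal, sub_zero] at h1
    rw [h1, hvr]
    nlinarith [sq_nonneg (x i - 1 / 2)]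
  have h := tendsto_integral_abs hlim (C := 2) (fun m => integrable_finiteLaw _ _ _ _) hν2 hsq hνC
  have hlimval : ∫ y, |y| ∂(ν : Measure ℝ) = 2 * Real.sqrt (x i * (1 - x i) / Real.pi) := by
    rw [show (ν : Measure ℝ) = gaussianReal 0 v from rfl, integral_abs_gaussianReal hv0, hvr,
      show 2 * (2 * (x i * (1 - x i))) / Real.pi = 2 ^ 2 * (x i * (1 - x i) / Real.pi) by ring,
      Real.sqrt_mul (by norm_num), Real.sqrt_sq (by norm_num)]
  rw [hlimval] at h
  refine h.congr fun m => ?_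
  change ∫ y, |y| ∂(differenceLaw m x i) = _
  rw [integral_differenceLaw hx' hx1]
  simp only [abs_mul, multinomialExp_const_mul]
  rw [abs_of_nonneg (by positivity)]

end MeanDifference

/-! ### Second-order Taylor estimates on a convex set. -/

section Taylor

variable {E : Type*} [NormedAddCommGroup E] [NormedSpace ℝ E]

/-- The segment from `x` to `y` stays in `S`; along it the mean value inequality is applied first to
the derivative, then to the function. The factor `1/2` available from integrating is not kept. -/
theorem abs_taylor_two_le {S : Set E} (hS : Convex ℝ S) {f : E → ℝ} {f' : E → E →L[ℝ] ℝ}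
    {f'' : E → E →L[ℝ] E →L[ℝ] ℝ} (h1 : ∀ z ∈ S, HasFDerivWithinAt f (f' z) S z)
    (h2 : ∀ z ∈ S, HasFDerivWithinAt f' (f'' z) S z) {x y : E} (hx : x ∈ S) (hy : y ∈ S) {M : ℝ}
    (hM : ∀ z ∈ S, ‖z - x‖ ≤ ‖y - x‖ → ‖f'' z - f'' x‖ ≤ M) :
    |f y - f x - f' x (y - x) - 1 / 2 * f'' x (y - x) (y - x)| ≤ M * ‖y - x‖ ^ 2 := by
  set v := y - x with hv
  have hmaps : Set.MapsTo (fun t : ℝ => x + t • v) (Set.Icc 0 1) S := fun t ht =>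
    hS.add_smul_sub_mem hx hy ht
  have hline (t : ℝ) : HasDerivWithinAt (fun t : ℝ => x + t • v) v (Set.Icc 0 1) t := by
    simpa using (((hasDerivAt_id t).smul_const v).const_add x).hasDerivWithinAt
  have hg (t : ℝ) (ht : t ∈ Set.Icc (0 : ℝ) 1) :
      HasDerivWithinAt (fun t : ℝ => f (x + t • v)) (f' (x + t • v) v) (Set.Icc 0 1) t :=
    (h1 _ (hmaps ht)).comp_hasDerivWithinAt t (hline t) hmaps
  have hg' (t : ℝ) (ht : t ∈ Set.Icc (0 : ℝ) 1) :
      HasDerivWithinAt (fun t : ℝ => f' (x + t • v) v) (f'' (x + t • v) v v) (Set.Icc 0 1) t := by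
    have h := (h2 _ (hmaps ht)).comp_hasDerivWithinAt t (hline t) hmaps
    simpa using h.clm_apply (hasDerivWithinAt_const t (Set.Icc 0 1) v)
  have hp (t : ℝ) (ht : t ∈ Set.Icc (0 : ℝ) 1) :
      ‖f' (x + t • v) v - f' x v - t * f'' x v v‖ ≤ M * ‖v‖ ^ 2 := by
    have hM0 : 0 ≤ M := (norm_nonneg (f'' x - f'' x)).trans (hM x hx (by simp))
    have hd (s : ℝ) (hs : s ∈ Set.Icc (0 : ℝ) 1) :
        HasDerivWithinAt (fun t : ℝ => f' (x + t • v) v - f' x v - t * f'' x v v)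
          (f'' (x + s • v) v v - f'' x v v) (Set.Icc 0 1) s := by
      simpa using ((hg' s hs).sub_const (f' x v)).fun_sub
        ((hasDerivWithinAt_id s (Set.Icc 0 1)).mul_const (f'' x v v))
    have hb (s : ℝ) (hs : s ∈ Set.Ico (0 : ℝ) 1) :
        ‖f'' (x + s • v) v v - f'' x v v‖ ≤ M * ‖v‖ ^ 2 := by
      have hs' : s ∈ Set.Icc (0 : ℝ) 1 := ⟨hs.1, hs.2.le⟩
      have h3 := hM _ (hmaps hs') (by
        rw [add_sub_cancel_left, norm_smul, Real.norm_of_nonneg hs.1]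
        exact mul_le_of_le_one_left (norm_nonneg _) hs.2.le)
      calc _ = ‖(f'' (x + s • v) - f'' x) v v‖ := by simp
        _ ≤ ‖f'' (x + s • v) - f'' x‖ * ‖v‖ * ‖v‖ := ContinuousLinearMap.le_opNorm₂ _ _ _
        _ ≤ M * ‖v‖ * ‖v‖ := by gcongr
        _ = _ := by ring
    have h := norm_image_sub_le_of_norm_deriv_le_segment' hd hb t ht
    simp only [zero_smul, add_zero, sub_self, zero_mul, sub_zero] at h
    exact h.trans (mul_le_of_le_one_right (by positivity) ht.2)
  have hd (s : ℝ) (hs : s ∈ Set.Icc (0 : ℝ) 1) :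
      HasDerivWithinAt (fun t : ℝ => f (x + t • v) - t * f' x v - t ^ 2 * (1 / 2 * f'' x v v))
        (f' (x + s • v) v - f' x v - s * f'' x v v) (Set.Icc 0 1) s := by
    have h3 := ((hg s hs).fun_sub ((hasDerivWithinAt_id s (Set.Icc 0 1)).mul_const (f' x v))).fun_sub
      ((hasDerivAt_pow 2 s).hasDerivWithinAt.mul_const (1 / 2 * f'' x v v))
    refine h3.congr_deriv ?_
    norm_num
    ring
  have h := norm_image_sub_le_of_norm_deriv_le_segment' hd
    (fun s hs => hp s ⟨hs.1, hs.2.le⟩) 1 (by simp)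
  simp only [zero_smul, add_zero, one_smul, sub_zero, mul_one, zero_mul, one_mul, Real.norm_eq_abs,
    one_pow, ne_eq, OfNat.ofNat_ne_zero, not_false_eq_true, zero_pow] at h
  rw [show x + v = y by simp [hv]] at h
  refine le_of_eq_of_le ?_ h
  congr 1
  ring

/-- Near `x`, uniform continuity of `f''` gives the `ε` term. At distance at least `δ`, boundedness
of `f''` suffices, because there `‖y - x‖² ≤ δ⁻² ‖y - x‖⁴`. The quartic form is what fourth moments
of the multinomial law can absorb. -/
theorem exists_abs_taylor_two_le {S : Set E} (hS : Convex ℝ S) (hc : IsCompact S) {f : E → ℝ}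
    {f' : E → E →L[ℝ] ℝ} {f'' : E → E →L[ℝ] E →L[ℝ] ℝ}
    (h1 : ∀ z ∈ S, HasFDerivWithinAt f (f' z) S z)
    (h2 : ∀ z ∈ S, HasFDerivWithinAt f' (f'' z) S z) (hcont : ContinuousOn f'' S) {ε : ℝ}
    (hε : 0 < ε) :
    ∃ K, 0 ≤ K ∧ ∀ x ∈ S, ∀ y ∈ S,
      |f y - f x - f' x (y - x) - 1 / 2 * f'' x (y - x) (y - x)| ≤
        ε * ‖y - x‖ ^ 2 + K * ‖y - x‖ ^ 4 := by
  obtain ⟨C, hC⟩ := hc.exists_bound_of_continuousOn (E := E →L[ℝ] E →L[ℝ] ℝ) hcont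
  obtain ⟨δ, hδ, hδf⟩ := (Metric.uniformContinuousOn_iff (β := E →L[ℝ] E →L[ℝ] ℝ)).1
    (hc.uniformContinuousOn_of_continuous (β := E →L[ℝ] E →L[ℝ] ℝ) hcont) ε hε
  refine ⟨2 * |C| / δ ^ 2, by positivity, fun x hx y hy => ?_⟩
  rcases lt_or_ge ‖y - x‖ δ with h | h
  · refine (abs_taylor_two_le hS h1 h2 hx hy (M := ε) fun z hz hzx => ?_).trans
      (le_add_of_nonneg_right (by positivity))
    have h3 := (hδf z hz x hx (by rw [dist_eq_norm]; linarith)).le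
    rwa [dist_eq_norm (E := E →L[ℝ] E →L[ℝ] ℝ)] at h3
  · refine (abs_taylor_two_le hS h1 h2 hx hy (M := 2 * |C|) fun z hz _ => ?_).trans ?_
    · have a1 := hC z hz
      have a2 := hC x hx
      linarith [norm_sub_le (f'' z) (f'' x), le_abs_self C]
    · have h3 : 2 * |C| * ‖y - x‖ ^ 2 ≤ 2 * |C| / δ ^ 2 * ‖y - x‖ ^ 4 := by
        rw [div_mul_eq_mul_div, le_div_iff₀ (by positivity)]
        have : δ ^ 2 ≤ ‖y - x‖ ^ 2 := by gcongr
        calc _ ≤ 2 * |C| * ‖y - x‖ ^ 2 * ‖y - x‖ ^ 2 := by gcongr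
          _ = _ := by ring
      have : 0 ≤ ε * ‖y - x‖ ^ 2 := by positivity
      linarith

end Taylor

/-! ### Geometry of the simplex and Taylor bounds in coordinates. -/

section Simplex

variable {d : ℕ}

theorem mem_simplex_iff {x : Fin d → ℝ} : x ∈ simplex d ↔ (∀ i, 0 ≤ x i) ∧ l1Norm x ≤ 1 :=
  ⟨fun h => ⟨fun i => (h.1 i).1, h.2⟩,
    fun h => ⟨fun i => ⟨h.1 i, le_one_of_l1Norm_le h.2 i⟩, h.2⟩⟩

theorem simplexInterior_subset : simplexInterior d ⊆ simplex d :=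
  fun _ hx => mem_simplex_iff.2 ⟨fun i => (hx.1 i).1.le, hx.2.le⟩

theorem continuous_l1Norm : Continuous (l1Norm : (Fin d → ℝ) → ℝ) := by
  unfold l1Norm
  fun_prop

theorem isOpen_simplexInterior : IsOpen (simplexInterior d) := by
  have h : simplexInterior d = Set.univ.pi (fun _ => Set.Ioo (0 : ℝ) 1) ∩ l1Norm ⁻¹' Set.Iio 1 := by
    ext x
    simp [simplexInterior]
  rw [h]
  exact (isOpen_set_pi Set.finite_univ fun _ _ => isOpen_Ioo).inter
    (isOpen_Iio.preimage continuous_l1Norm)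

theorem isCompact_simplex : IsCompact (simplex d) := by
  have h : simplex d = Set.univ.pi (fun _ => Set.Icc (0 : ℝ) 1) ∩ l1Norm ⁻¹' Set.Iic 1 := by
    ext x
    simp [simplex, forall_and, Pi.le_def]
  rw [h]
  exact (isCompact_univ_pi fun _ => isCompact_Icc).inter_right
    (isClosed_Iic.preimage continuous_l1Norm)

theorem convex_simplex : Convex ℝ (simplex d) := by
  intro x hx y hy a b ha hb hab
  rw [mem_simplex_iff] at *
  have h0 (i : Fin d) : 0 ≤ (a • x + b • y) i :=
    add_nonneg (mul_nonneg ha (hx.1 i)) (mul_nonneg hb (hy.1 i))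
  refine ⟨h0, ?_⟩
  rw [l1Norm_eq_sum h0]
  rw [l1Norm_eq_sum hx.1, l1Norm_eq_sum hy.1] at *
  simp only [Pi.add_apply, Pi.smul_apply, smul_eq_mul, Finset.sum_add_distrib, ← Finset.mul_sum]
  nlinarith [hx.2, hy.2]

theorem simplex_mem_nhds {x : Fin d → ℝ} (hx : x ∈ simplexInterior d) : simplex d ∈ 𝓝 x :=
  mem_of_superset (isOpen_simplexInterior.mem_nhds hx) simplexInterior_subset

theorem div_mem_simplex {m : ℕ} {k : Fin d → ℕ} (hk : ∑ i, k i ≤ m) :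
    (fun i => (k i : ℝ) / m) ∈ simplex d := by
  have h0 (i : Fin d) : 0 ≤ (k i : ℝ) / m := by positivity
  refine mem_simplex_iff.2 ⟨h0, ?_⟩
  rw [l1Norm_eq_sum h0, ← Finset.sum_div]
  exact div_le_one_of_le₀ (by exact_mod_cast hk) (by positivity)

/-- The quadratic form of the Hessian of `F` at `x`, applied to `v`. -/
noncomputable def hessianForm (F : (Fin d → ℝ) → ℝ) (x v : Fin d → ℝ) : ℝ :=
  ∑ i, ∑ j, partialDeriv i (partialDeriv j F) x * (v i * v j)

/-- A convex set with nonempty interior has unique derivatives within it, so derivatives within the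
simplex are continuous up to the boundary. In the open interior they agree with the partial
derivatives. -/
theorem exists_derivatives {F : (Fin d → ℝ) → ℝ} (hC2 : ContDiffOn ℝ 2 F (simplex d))
    (hne : (simplexInterior d).Nonempty) :
    ∃ (f' : (Fin d → ℝ) → (Fin d → ℝ) →L[ℝ] ℝ)
      (f'' : (Fin d → ℝ) → (Fin d → ℝ) →L[ℝ] (Fin d → ℝ) →L[ℝ] ℝ),
      (∀ z ∈ simplex d, HasFDerivWithinAt F (f' z) (simplex d) z) ∧
      (∀ z ∈ simplex d, HasFDerivWithinAt f' (f'' z) (simplex d) z) ∧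
      ContinuousOn f'' (simplex d) ∧
      (∀ x ∈ simplexInterior d, ∀ i, partialDeriv i F x = f' x (Pi.single i 1)) ∧
      (∀ x ∈ simplexInterior d, ∀ i j,
        partialDeriv i (partialDeriv j F) x = f'' x (Pi.single i 1) (Pi.single j 1)) := by
  have hint : (interior (simplex d)).Nonempty :=
    hne.mono (interior_maximal simplexInterior_subset isOpen_simplexInterior)
  have hU : UniqueDiffOn ℝ (simplex d) := uniqueDiffOn_convex convex_simplex hint
  have h1 : ContDiffOn ℝ 1 (fderivWithin ℝ F (simplex d)) (simplex d) :=
    hC2.fderivWithin hU (by norm_num)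
  have h0 : ContDiffOn ℝ 0 (fderivWithin ℝ (fderivWithin ℝ F (simplex d)) (simplex d))
    (simplex d) := h1.fderivWithin hU (by norm_num)
  have d1 : ∀ z ∈ simplex d, HasFDerivWithinAt F (fderivWithin ℝ F (simplex d) z) (simplex d) z :=
    fun z hz => (hC2.differentiableOn (by norm_num) z hz).hasFDerivWithinAt
  have d2 : ∀ z ∈ simplex d, HasFDerivWithinAt (fderivWithin ℝ F (simplex d))
      (fderivWithin ℝ (fderivWithin ℝ F (simplex d)) (simplex d) z) (simplex d) z :=
    fun z hz => (h1.differentiableOn (by norm_num) z hz).hasFDerivWithinAt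
  have e1 : ∀ x ∈ simplexInterior d, ∀ i,
      partialDeriv i F x = fderivWithin ℝ F (simplex d) x (Pi.single i 1) := fun x hx i =>
    (((d1 x (simplexInterior_subset hx)).hasFDerivAt
      (simplex_mem_nhds hx)).hasLineDerivAt _).lineDeriv
  refine ⟨_, _, d1, d2, h0.continuousOn, e1, fun x hx i j => ?_⟩
  have hev : partialDeriv j F =ᶠ[𝓝 x]
      fun z => fderivWithin ℝ F (simplex d) z (Pi.single j 1) := by
    filter_upwards [isOpen_simplexInterior.mem_nhds hx] with z hz using e1 z hz j
  have h3 := ((d2 x (simplexInterior_subset hx)).hasFDerivAt (simplex_mem_nhds hx)).clm_apply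
    (hasFDerivAt_const (Pi.single j (1 : ℝ)) x)
  rw [partialDeriv, hev.lineDeriv_eq, (h3.hasLineDerivAt _).lineDeriv]
  simp

theorem norm_pow_le_sum {n : ℕ} (hn : Even n) (hn0 : n ≠ 0) (v : Fin d → ℝ) :
    ‖v‖ ^ n ≤ ∑ i, v i ^ n := by
  rcases isEmpty_or_nonempty (Fin d) with h | h
  · simp [Subsingleton.elim v 0, hn0]
  · obtain ⟨i, hi⟩ := Finite.exists_max fun i => ‖v i‖
    have hv : ‖v‖ ≤ ‖v i‖ := (pi_norm_le_iff_of_nonneg (norm_nonneg _)).2 hi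
    calc _ ≤ ‖v i‖ ^ n := by gcongr
      _ = v i ^ n := hn.pow_abs _
      _ ≤ _ := Finset.single_le_sum (f := fun i => v i ^ n) (fun _ _ => hn.pow_nonneg _)
        (Finset.mem_univ i)

theorem exists_taylor_remainder_le {F : (Fin d → ℝ) → ℝ} (hC2 : ContDiffOn ℝ 2 F (simplex d))
    {ε : ℝ} (hε : 0 < ε) :
    ∃ K, 0 ≤ K ∧ ∀ x ∈ simplexInterior d, ∀ y ∈ simplex d,
      |F y - F x - ∑ i, partialDeriv i F x * (y i - x i) - 1 / 2 * hessianForm F x (y - x)| ≤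
        ε * ∑ i, (y i - x i) ^ 2 + K * ∑ i, (y i - x i) ^ 4 := by
  rcases (simplexInterior d).eq_empty_or_nonempty with h | h
  · exact ⟨0, le_rfl, by simp [h]⟩
  obtain ⟨f', f'', d1, d2, hc, e1, e2⟩ := exists_derivatives hC2 h
  obtain ⟨K, hK0, hK⟩ := exists_abs_taylor_two_le convex_simplex isCompact_simplex d1 d2 hc hε
  refine ⟨K, hK0, fun x hx y hy => ?_⟩
  have h1 (v : Fin d → ℝ) (L : (Fin d → ℝ) →L[ℝ] ℝ) : L v = ∑ i, L (Pi.single i 1) * v i := by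
    conv_lhs => rw [← Finset.univ_sum_single v]
    rw [map_sum]
    refine Finset.sum_congr rfl fun i _ => ?_
    rw [mul_comm, ← smul_eq_mul, ← map_smul, ← Pi.single_smul, smul_eq_mul, mul_one]
  have h2 : f' x (y - x) = ∑ i, partialDeriv i F x * (y i - x i) := by
    rw [h1]
    simp only [e1 x hx, Pi.sub_apply]
  have h3 : f'' x (y - x) (y - x) = hessianForm F x (y - x) := by
    rw [h1, hessianForm, Finset.sum_comm]
    refine Finset.sum_congr rfl fun j _ => ?_
    rw [← ContinuousLinearMap.flip_apply, h1, Finset.sum_mul]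
    refine Finset.sum_congr rfl fun i _ => ?_
    rw [ContinuousLinearMap.flip_apply, e2 x hx]
    ring
  have h4 := hK x (simplexInterior_subset hx) y hy
  rw [h2, h3] at h4
  refine h4.trans ?_
  have a2 := norm_pow_le_sum (n := 2) (by decide) (by decide) (y - x)
  have a4 := norm_pow_le_sum (n := 4) (by decide) (by decide) (y - x)
  simp only [Pi.sub_apply] at a2 a4
  gcongr

theorem exists_hessian_bound {F : (Fin d → ℝ) → ℝ} (hC2 : ContDiffOn ℝ 2 F (simplex d)) :
    ∃ C, 0 ≤ C ∧ ∀ x ∈ simplexInterior d, ∀ i j, |partialDeriv i (partialDeriv j F) x| ≤ C := by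
  rcases (simplexInterior d).eq_empty_or_nonempty with h | h
  · exact ⟨0, le_rfl, by simp [h]⟩
  obtain ⟨f', f'', -, -, hc, -, e2⟩ := exists_derivatives hC2 h
  obtain ⟨C, hC⟩ := isCompact_simplex.exists_bound_of_continuousOn
    (E := (Fin d → ℝ) →L[ℝ] (Fin d → ℝ) →L[ℝ] ℝ) hc
  refine ⟨|C|, abs_nonneg C, fun x hx i j => ?_⟩
  rw [e2 x hx, ← Real.norm_eq_abs]
  refine (ContinuousLinearMap.le_opNorm₂ _ _ _).trans ?_
  rw [Pi.norm_single, Pi.norm_single, norm_one, mul_one, mul_one]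
  exact (hC x (simplexInterior_subset hx)).trans (le_abs_self C)

end Simplex

/-! ### The bias. -/

section Bias

variable {d : ℕ} {F : (Fin d → ℝ) → ℝ} {x : Fin d → ℝ}

theorem bernsteinPoly_eq_multinomialExp (G : (Fin d → ℝ) → ℝ) (m : ℕ) (x : Fin d → ℝ) :
    bernsteinPoly G m x = multinomialExp m x (fun k => G (fun i => (k i : ℝ) / m)) :=
  Finset.sum_congr rfl fun _ _ => mul_comm _ _

theorem div_sub_eq_centered {m : ℕ} (hm : 0 < m) (k : Fin d → ℕ) (i : Fin d) :
    (k i : ℝ) / m - x i = (m : ℝ)⁻¹ * centered x m i k := by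
  have : (m : ℝ) ≠ 0 := by positivity
  rw [centered]
  field_simp

theorem multinomialExp_sq_sum_le (hx : ∀ i, 0 ≤ x i) {m : ℕ} (hm : 0 < m) :
    multinomialExp m x (fun k => ∑ i, ((k i : ℝ) / m - x i) ^ 2) ≤ d / 4 * (m : ℝ)⁻¹ := by
  have hm0 : (0 : ℝ) < m := by exact_mod_cast hm
  simp only [div_sub_eq_centered hm, mul_pow, multinomialExp_sum, multinomialExp_const_mul]
  calc _ ≤ ∑ _i : Fin d, (m : ℝ)⁻¹ ^ 2 * ((m : ℝ) / 4) := Finset.sum_le_sum fun i _ =>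
        mul_le_mul_of_nonneg_left (multinomialExp_centered_sq_le hx m i) (by positivity)
    _ = _ := by
        simp only [Finset.sum_const, Finset.card_univ, Fintype.card_fin, nsmul_eq_mul]
        field_simp

theorem multinomialExp_pow_four_sum_le (hx : ∀ i, 0 ≤ x i) (hx1 : l1Norm x ≤ 1) {m : ℕ}
    (hm : 0 < m) :
    multinomialExp m x (fun k => ∑ i, ((k i : ℝ) / m - x i) ^ 4) ≤ 3 * d * (m : ℝ)⁻¹ ^ 2 := by
  have hm0 : (0 : ℝ) < m := by exact_mod_cast hm
  simp only [div_sub_eq_centered hm, mul_pow, multinomialExp_sum, multinomialExp_const_mul]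
  calc _ ≤ ∑ _i : Fin d, (m : ℝ)⁻¹ ^ 4 * (3 * (m : ℝ) ^ 2) := Finset.sum_le_sum fun i _ =>
        mul_le_mul_of_nonneg_left (multinomialExp_centered_pow_four_le hx hx1 m i) (by positivity)
    _ = _ := by
        simp only [Finset.sum_const, Finset.card_univ, Fintype.card_fin, nsmul_eq_mul]
        field_simp

theorem multinomialExp_hessianForm (hx : ∀ i, 0 ≤ x i) {m : ℕ} (hm : 0 < m) :
    multinomialExp m x (fun k => 1 / 2 * hessianForm F x ((fun i => (k i : ℝ) / m) - x)) =
      (m : ℝ)⁻¹ * biasCoeff F x := by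
  have hm0 : (m : ℝ) ≠ 0 := by positivity
  have h (k : Fin d → ℕ) (i j : Fin d) : partialDeriv i (partialDeriv j F) x *
      (((m : ℝ)⁻¹ * centered x m i k) * ((m : ℝ)⁻¹ * centered x m j k)) =
      (partialDeriv i (partialDeriv j F) x * (m : ℝ)⁻¹ ^ 2) *
        (centered x m i k * centered x m j k) := by ring
  simp only [hessianForm, Pi.sub_apply, div_sub_eq_centered hm, multinomialExp_sum,
    multinomialExp_const_mul, h, multinomialExp_centered_mul hx, biasCoeff]
  rw [mul_left_comm, Finset.mul_sum Finset.univ _ (m : ℝ)⁻¹]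
  congr 1
  refine Finset.sum_congr rfl fun i _ => ?_
  rw [Finset.mul_sum]
  refine Finset.sum_congr rfl fun j _ => ?_
  field_simp

theorem multinomialExp_linear (hx : ∀ i, 0 ≤ x i) {m : ℕ} (hm : 0 < m) (A : Fin d → ℝ) :
    multinomialExp m x (fun k => ∑ i, A i * ((k i : ℝ) / m - x i)) = 0 := by
  simp only [div_sub_eq_centered hm, multinomialExp_sum, multinomialExp_const_mul]
  exact Finset.sum_eq_zero fun i _ => by
    rw [show multinomialExp m x (fun k => centered x m i k) = 0 from multinomialExp_centered hx m i]
    simp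

/-- The bias of the Bernstein estimator, uniformly over the simplex. -/
theorem eventually_abs_bias_le (hC2 : ContDiffOn ℝ 2 F (simplex d)) {ε : ℝ} (hε : 0 < ε) :
    ∀ᶠ m : ℕ in atTop, ∀ x ∈ simplexInterior d,
      |bernsteinPoly F m x - F x - (m : ℝ)⁻¹ * biasCoeff F x| ≤ ε * (m : ℝ)⁻¹ := by
  -- The second moments sum to at most `d/(4m)`, so this term costs at most `(ε/2)/m`; the `+ 1`
  -- covers `d = 0`.
  obtain ⟨K, hK0, hK⟩ := exists_taylor_remainder_le hC2 (ε := ε / (d + 1)) (by positivity)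
  have hlim : Tendsto (fun m : ℕ => K * (3 * d) * (m : ℝ)⁻¹) atTop (𝓝 0) := by
    simpa using tendsto_natCast_atTop_atTop.inv_tendsto_atTop.const_mul (K * (3 * d : ℝ))
  filter_upwards [eventually_gt_atTop 0, hlim.eventually_le_const (show 0 < ε / 2 by positivity)]
    with m hm hmK x hx
  have hx0 := fun i => (hx.1 i).1.le
  have hm0 : (0 : ℝ) < m := by exact_mod_cast hm
  have h1 : bernsteinPoly F m x - F x - (m : ℝ)⁻¹ * biasCoeff F x = multinomialExp m x (fun k =>
      F (fun i => (k i : ℝ) / m) - F x - ∑ i, partialDeriv i F x * ((k i : ℝ) / m - x i) -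
        1 / 2 * hessianForm F x ((fun i => (k i : ℝ) / m) - x)) := by
    rw [multinomialExp_sub, multinomialExp_sub, multinomialExp_sub, multinomialExp_const hx0,
      multinomialExp_linear hx0 hm, multinomialExp_hessianForm hx0 hm,
      bernsteinPoly_eq_multinomialExp, sub_zero]
  rw [h1]
  refine (abs_multinomialExp_le hx0 hx.2.le fun k hk => hK x hx _ (div_mem_simplex hk)).trans ?_
  rw [multinomialExp_add, multinomialExp_const_mul, multinomialExp_const_mul]
  have a2 := multinomialExp_sq_sum_le hx0 hm
  have a4 := multinomialExp_pow_four_sum_le hx0 hx.2.le hm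
  have hd : ε / (d + 1) * (d / 4 * (m : ℝ)⁻¹) ≤ ε / 2 * (m : ℝ)⁻¹ := by
    rw [← mul_assoc]
    gcongr
    rw [div_mul_eq_mul_div, div_le_iff₀ (by positivity)]
    have : (0 : ℝ) ≤ d := by positivity
    nlinarith
  calc _ ≤ ε / (d + 1) * (d / 4 * (m : ℝ)⁻¹) + K * (3 * d * (m : ℝ)⁻¹ ^ 2) := by gcongr
    _ ≤ ε / 2 * (m : ℝ)⁻¹ + K * (3 * d) * (m : ℝ)⁻¹ * (m : ℝ)⁻¹ := by
        refine add_le_add hd (le_of_eq (by ring))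
    _ ≤ ε / 2 * (m : ℝ)⁻¹ + ε / 2 * (m : ℝ)⁻¹ := by gcongr
    _ = _ := by ring

theorem exists_biasCoeff_bound (hC2 : ContDiffOn ℝ 2 F (simplex d)) :
    ∃ C, 0 ≤ C ∧ ∀ x ∈ simplexInterior d, |biasCoeff F x| ≤ C := by
  obtain ⟨C, hC0, hC⟩ := exists_hessian_bound hC2
  refine ⟨1 / 2 * ∑ _i : Fin d, ∑ _j : Fin d, 2 * C, by positivity, fun x hx => ?_⟩
  rw [biasCoeff, abs_mul, abs_of_pos (by norm_num : (0 : ℝ) < 1 / 2)]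
  gcongr
  refine (Finset.abs_sum_le_sum_abs _ _).trans (Finset.sum_le_sum fun i _ => ?_)
  refine (Finset.abs_sum_le_sum_abs _ _).trans (Finset.sum_le_sum fun j _ => ?_)
  rw [abs_mul]
  refine mul_le_mul ?_ (hC x hx i j) (abs_nonneg _) (by norm_num)
  have hi := hx.1 i
  have hj := hx.1 j
  have h1 : 0 ≤ x i * x j := mul_nonneg hi.1.le hj.1.le
  have h2 : x i * x j ≤ 1 := mul_le_one₀ hi.2.le hj.1.le hj.2.le
  rw [abs_le]
  split_ifs <;> constructor <;> linarith [hi.1, hi.2]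

/-- Derived from the second-order bound: the Hessian is bounded, and fourth powers are at most
squares because coordinates differ by at most 1. -/
theorem exists_first_order_remainder_le (hC2 : ContDiffOn ℝ 2 F (simplex d)) :
    ∃ K, 0 ≤ K ∧ ∀ x ∈ simplexInterior d, ∀ y ∈ simplex d,
      |F y - F x - ∑ i, partialDeriv i F x * (y i - x i)| ≤ K * ∑ i, (y i - x i) ^ 2 := by
  obtain ⟨K, hK0, hK⟩ := exists_taylor_remainder_le hC2 one_pos
  obtain ⟨C, hC0, hC⟩ := exists_hessian_bound hC2
  refine ⟨1 + K + C * d, by positivity, fun x hx y hy => ?_⟩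
  have h1 := hK x hx y hy
  have h4 : ∑ i, (y i - x i) ^ 4 ≤ ∑ i, (y i - x i) ^ 2 := by
    refine Finset.sum_le_sum fun i _ => ?_
    have : (y i - x i) ^ 2 ≤ 1 := by
      have hi := hx.1 i
      have hj := hy.1 i
      rw [sq_le_one_iff_abs_le_one, abs_le]
      constructor <;> linarith [hi.1, hi.2, hj.1, hj.2]
    nlinarith [sq_nonneg (y i - x i)]
  have hH : |hessianForm F x (y - x)| ≤ C * d * ∑ i, (y i - x i) ^ 2 := by
    calc _ ≤ ∑ i, ∑ j, C * (((y i - x i) ^ 2 + (y j - x j) ^ 2) / 2) := by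
          refine (Finset.abs_sum_le_sum_abs _ _).trans (Finset.sum_le_sum fun i _ => ?_)
          refine (Finset.abs_sum_le_sum_abs _ _).trans (Finset.sum_le_sum fun j _ => ?_)
          rw [abs_mul]
          refine mul_le_mul (hC x hx i j) ?_ (abs_nonneg _) hC0
          simp only [Pi.sub_apply]
          rw [abs_le]
          constructor <;> nlinarith [sq_nonneg ((y i - x i) + (y j - x j)),
            sq_nonneg ((y i - x i) - (y j - x j))]
      _ = _ := by
          simp only [← Finset.mul_sum, ← Finset.sum_div, Finset.sum_add_distrib, Finset.sum_const,
            Finset.card_univ, Fintype.card_fin, nsmul_eq_mul]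
          ring
  have h5 : K * ∑ i, (y i - x i) ^ 4 ≤ K * ∑ i, (y i - x i) ^ 2 := by gcongr
  rw [abs_le] at h1 hH ⊢
  have h6 : 0 ≤ C * d * ∑ i, (y i - x i) ^ 2 := by positivity
  constructor <;> linarith [h1.1, h1.2, hH.1, hH.2]

end Bias

/-! ### The second moment of the kernel. -/

section SecondMoment

variable {d : ℕ} {F : (Fin d → ℝ) → ℝ} {x : Fin d → ℝ}

/-- The mean of `F((K ∧ L) / m)` for independent `Multinomial(m, x)` vectors `K` and `L`. -/
noncomputable def infMean (F : (Fin d → ℝ) → ℝ) (m : ℕ) (x : Fin d → ℝ) : ℝ :=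
  multinomialExp m x (fun k => multinomialExp m x (fun l =>
    F (fun i => ((min (k i) (l i) : ℕ) : ℝ) / m)))

theorem sum_min_le {m : ℕ} {k l : Fin d → ℕ} (hk : ∑ i, k i ≤ m) : ∑ i, min (k i) (l i) ≤ m :=
  (Finset.sum_le_sum fun _ _ => min_le_left _ _).trans hk

/-- Of these three terms only the absolute difference survives averaging; it is the source of `V`.
-/
theorem min_div_sub_eq {m : ℕ} (hm : 0 < m) (k l : Fin d → ℕ) (i : Fin d) :
    ((min (k i) (l i) : ℕ) : ℝ) / m - x i =
      1 / 2 * ((k i : ℝ) / m - x i) + 1 / 2 * ((l i : ℝ) / m - x i) +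
        (-(1 / 2) * (m : ℝ)⁻¹) * |(k i : ℝ) - l i| := by
  have hm0 : (m : ℝ) ≠ 0 := by positivity
  have h : ((min (k i) (l i) : ℕ) : ℝ) = ((k i : ℝ) + l i - |(k i : ℝ) - l i|) / 2 := by
    rw [Nat.cast_min]
    rcases le_total (k i : ℝ) (l i) with h | h
    · rw [min_eq_left h, abs_of_nonpos (by linarith)]; ring
    · rw [min_eq_right h, abs_of_nonneg (by linarith)]; ring
  rw [h]
  field_simp
  ring

theorem sq_min_div_sub_le (m : ℕ) (k l : Fin d → ℕ) (i : Fin d) :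
    (((min (k i) (l i) : ℕ) : ℝ) / m - x i) ^ 2 ≤
      ((k i : ℝ) / m - x i) ^ 2 + ((l i : ℝ) / m - x i) ^ 2 := by
  rcases le_total (k i) (l i) with h | h
  · rw [min_eq_left h]
    exact le_add_of_nonneg_right (sq_nonneg _)
  · rw [min_eq_right h]
    exact le_add_of_nonneg_left (sq_nonneg _)

theorem multinomialExp_min_linear (hx : ∀ i, 0 ≤ x i) {m : ℕ} (hm : 0 < m) (A : Fin d → ℝ) :
    multinomialExp m x (fun k => multinomialExp m x (fun l =>
      ∑ i, A i * (((min (k i) (l i) : ℕ) : ℝ) / m - x i))) =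
    ∑ i, A i * ((-(1 / 2) * (m : ℝ)⁻¹) *
      multinomialExp m x (fun k => multinomialExp m x (fun l => |(k i : ℝ) - l i|))) := by
  have hc (i : Fin d) : multinomialExp m x (fun k => centered x m i k) = 0 :=
    multinomialExp_centered hx m i
  simp only [min_div_sub_eq hm, div_sub_eq_centered hm, multinomialExp_sum,
    multinomialExp_const_mul, multinomialExp_add, multinomialExp_const hx, hc, mul_zero, zero_add]

/-- First-order expansion at `(K ∧ L)/m`, which remains in the simplex. Each coordinate of it is one
of the two original ones, so the quadratic remainder is controlled by the two variances. -/
theorem exists_abs_infMean_sub_le (hC2 : ContDiffOn ℝ 2 F (simplex d)) :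
    ∃ K, 0 ≤ K ∧ ∀ x ∈ simplexInterior d, ∀ m : ℕ, 0 < m →
      |infMean F m x - F x - ∑ i, partialDeriv i F x * ((-(1 / 2) * (m : ℝ)⁻¹) *
        multinomialExp m x (fun k => multinomialExp m x (fun l => |(k i : ℝ) - l i|)))| ≤
        K * (m : ℝ)⁻¹ := by
  obtain ⟨K, hK0, hK⟩ := exists_first_order_remainder_le hC2
  refine ⟨K * (d / 4 + d / 4), by positivity, fun x hx m hm => ?_⟩
  have hx0 := fun i => (hx.1 i).1.le
  have h2 := multinomialExp_sq_sum_le hx0 hm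
  rw [← multinomialExp_min_linear hx0 hm]
  have h1 : infMean F m x - F x = multinomialExp m x (fun k => multinomialExp m x (fun l =>
      F (fun i => ((min (k i) (l i) : ℕ) : ℝ) / m) - F x)) := by
    simp only [multinomialExp_sub, multinomialExp_const hx0, infMean]
  rw [h1, ← multinomialExp_sub]
  simp only [← multinomialExp_sub]
  calc _ ≤ multinomialExp m x (fun k => multinomialExp m x (fun l =>
        K * (∑ i, ((k i : ℝ) / m - x i) ^ 2 + ∑ i, ((l i : ℝ) / m - x i) ^ 2))) := by
        refine abs_multinomialExp_le hx0 hx.2.le fun k hk =>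
          abs_multinomialExp_le hx0 hx.2.le fun l _ => ?_
        refine (hK x hx _ (div_mem_simplex (sum_min_le hk))).trans ?_
        rw [← Finset.sum_add_distrib]
        gcongr with i
        exact sq_min_div_sub_le m k l i
    _ = K * (multinomialExp m x (fun k => ∑ i, ((k i : ℝ) / m - x i) ^ 2) +
        multinomialExp m x (fun k => ∑ i, ((k i : ℝ) / m - x i) ^ 2)) := by
        simp only [multinomialExp_const_mul, multinomialExp_add, multinomialExp_const hx0]
    _ ≤ K * (d / 4 * (m : ℝ)⁻¹ + d / 4 * (m : ℝ)⁻¹) := by gcongr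
    _ = _ := by ring

theorem tendsto_sqrt_mul_inv : Tendsto (fun m : ℕ => Real.sqrt m * (m : ℝ)⁻¹) atTop (𝓝 0) := by
  have h : Tendsto (fun m : ℕ => (Real.sqrt m)⁻¹) atTop (𝓝 0) :=
    tendsto_inv_atTop_zero.comp (Real.tendsto_sqrt_atTop.comp tendsto_natCast_atTop_atTop)
  refine h.congr fun m => ?_
  rw [← div_eq_mul_inv, Real.sqrt_div_self]

theorem tendsto_sqrt_mul_infMean_sub (hC2 : ContDiffOn ℝ 2 F (simplex d))
    (hx : x ∈ simplexInterior d) :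
    Tendsto (fun m : ℕ => Real.sqrt m * (infMean F m x - F x)) atTop (𝓝 (-varCoeff F x)) := by
  obtain ⟨K, hK0, hK⟩ := exists_abs_infMean_sub_le hC2
  have h1 : Tendsto (fun m : ℕ => ∑ i, partialDeriv i F x * (-(1 / 2) * ((Real.sqrt m)⁻¹ *
      multinomialExp m x (fun k => multinomialExp m x (fun l => |(k i : ℝ) - l i|))))) atTop
      (𝓝 (-varCoeff F x)) := by
    have : -varCoeff F x = ∑ i, partialDeriv i F x *
        (-(1 / 2) * (2 * Real.sqrt (x i * (1 - x i) / Real.pi))) := by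
      rw [varCoeff, ← Finset.sum_neg_distrib]
      exact Finset.sum_congr rfl fun i _ => by ring
    rw [this]
    exact tendsto_finsetSum _ fun i _ => ((tendsto_multinomialExp_abs_sub (fun i => (hx.1 i).1)
      hx.2.le i (hx.1 i).2).const_mul _).const_mul _
  have h2 : Tendsto (fun m : ℕ => Real.sqrt m * (infMean F m x - F x) -
      ∑ i, partialDeriv i F x * (-(1 / 2) * ((Real.sqrt m)⁻¹ *
      multinomialExp m x (fun k => multinomialExp m x (fun l => |(k i : ℝ) - l i|))))) atTop
      (𝓝 0) := by
    have h3 : Tendsto (fun m : ℕ => K * (Real.sqrt m * (m : ℝ)⁻¹)) atTop (𝓝 0) := by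
      simpa using tendsto_sqrt_mul_inv.const_mul K
    refine squeeze_zero_norm' ?_ h3
    filter_upwards [eventually_gt_atTop 0] with m hm
    have h4 := mul_le_mul_of_nonneg_left (hK x hx m hm) (Real.sqrt_nonneg m)
    rw [← abs_of_nonneg (Real.sqrt_nonneg (m : ℝ)), ← abs_mul, abs_of_nonneg (Real.sqrt_nonneg m),
      mul_sub, Finset.mul_sum] at h4
    rw [Real.norm_eq_abs]
    refine le_of_eq_of_le ?_ (h4.trans (le_of_eq (by ring)))
    congr 2
    refine Finset.sum_congr rfl fun i _ => ?_
    rw [← Real.sqrt_div_self (x := (m : ℝ)), div_eq_mul_inv]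
    ring
  simpa using h2.add h1

end SecondMoment

/-! ### Exact variance and squared bias decomposition. -/

section MeanSquaredError

variable {d : ℕ}

/-- The contribution of a single observation at `z` to the Bernstein estimator. -/
noncomputable def bernsteinKernel (m : ℕ) (x z : Fin d → ℝ) : ℝ :=
  multinomialExp m x (fun k =>
    (Set.Iic (fun i => (k i : ℝ) / (m : ℝ))).indicator (fun _ => (1 : ℝ)) z)

theorem bernsteinEstimator_eq {Ω : Type*} (X : ℕ → Ω → (Fin d → ℝ)) (n m : ℕ) (x : Fin d → ℝ) (ω : Ω) :
    bernsteinEstimator X n m x ω =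
      (n : ℝ)⁻¹ * ∑ i ∈ Finset.range n, bernsteinKernel m x (X i ω) := by
  simp only [bernsteinEstimator, bernsteinPoly_eq_multinomialExp, empiricalCDF,
    multinomialExp_const_mul, multinomialExp_sum, bernsteinKernel]

theorem integral_indicator_Iic (μ : Measure (Fin d → ℝ)) (y : Fin d → ℝ) :
    ∫ z, (Set.Iic y).indicator (fun _ => (1 : ℝ)) z ∂μ = jointCDF μ y := by
  rw [integral_indicator_const _ measurableSet_Iic]
  simp [jointCDF]

variable {μ : Measure (Fin d → ℝ)} [IsProbabilityMeasure μ]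

theorem integrable_indicator_Iic (y : Fin d → ℝ) :
    Integrable ((Set.Iic y).indicator (fun _ => (1 : ℝ))) μ :=
  (integrable_const 1).indicator measurableSet_Iic

theorem measurable_bernsteinKernel (m : ℕ) (x : Fin d → ℝ) :
    Measurable (bernsteinKernel m x) := by
  unfold bernsteinKernel multinomialExp
  exact Finset.measurable_sum _ fun k _ =>
    (measurable_const.indicator measurableSet_Iic).const_mul _

theorem integral_multinomialExp {α : Type*} [MeasurableSpace α] {ν : Measure α} (m : ℕ)
    (x : Fin d → ℝ) {G : (Fin d → ℕ) → α → ℝ} (hG : ∀ k, Integrable (G k) ν) :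
    ∫ z, multinomialExp m x (fun k => G k z) ∂ν =
      multinomialExp m x (fun k => ∫ z, G k z ∂ν) := by
  simp only [multinomialExp]
  rw [integral_finsetSum _ fun k _ => (hG k).fun_smul _]
  simp only [integral_smul]

theorem integrable_multinomialExp {α : Type*} [MeasurableSpace α] {ν : Measure α} (m : ℕ)
    (x : Fin d → ℝ) {G : (Fin d → ℕ) → α → ℝ} (hG : ∀ k, Integrable (G k) ν) :
    Integrable (fun z => multinomialExp m x (fun k => G k z)) ν :=
  integrable_finsetSum _ fun k _ => (hG k).const_mul _

theorem integral_bernsteinKernel (m : ℕ) (x : Fin d → ℝ) :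
    ∫ z, bernsteinKernel m x z ∂μ = bernsteinPoly (jointCDF μ) m x := by
  simp only [bernsteinKernel]
  rw [integral_multinomialExp m x fun k => integrable_indicator_Iic _]
  simp only [integral_indicator_Iic, bernsteinPoly_eq_multinomialExp]

theorem indicator_Iic_mul_indicator_Iic (m : ℕ) (k l : Fin d → ℕ) (z : Fin d → ℝ) :
    (Set.Iic (fun i => (k i : ℝ) / (m : ℝ))).indicator (fun _ => (1 : ℝ)) z *
      (Set.Iic (fun i => (l i : ℝ) / (m : ℝ))).indicator (fun _ => (1 : ℝ)) z =
    (Set.Iic (fun i => ((min (k i) (l i) : ℕ) : ℝ) / (m : ℝ))).indicator (fun _ => (1 : ℝ)) z := by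
  have h : (fun i => ((min (k i) (l i) : ℕ) : ℝ) / (m : ℝ)) =
      (fun i => (k i : ℝ) / (m : ℝ)) ⊓ (fun i => (l i : ℝ) / (m : ℝ)) := by
    ext i
    rw [Nat.cast_min, ← min_div_div_right (by positivity)]
    rfl
  rw [h, ← Set.Iic_inter_Iic, ← Set.inter_indicator_mul, one_mul]

/-- Lower orthants intersect in the lower orthant of the infimum, so squaring the kernel brings in a
second independent index and the minimum of the two. -/
theorem bernsteinKernel_sq (m : ℕ) (x z : Fin d → ℝ) :
    bernsteinKernel m x z ^ 2 = multinomialExp m x (fun k => multinomialExp m x (fun l =>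
      (Set.Iic (fun i => ((min (k i) (l i) : ℕ) : ℝ) / (m : ℝ))).indicator
        (fun _ => (1 : ℝ)) z)) := by
  simp only [← indicator_Iic_mul_indicator_Iic, multinomialExp_const_mul]
  rw [sq]
  nth_rewrite 1 [bernsteinKernel]
  rw [mul_comm, ← multinomialExp_const_mul]
  simp only [bernsteinKernel, mul_comm]

theorem integral_bernsteinKernel_sq (m : ℕ) (x : Fin d → ℝ) :
    ∫ z, bernsteinKernel m x z ^ 2 ∂μ = infMean (jointCDF μ) m x := by
  simp only [bernsteinKernel_sq]
  rw [integral_multinomialExp m x fun k =>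
    integrable_multinomialExp m x fun l => integrable_indicator_Iic _]
  congr 1
  ext k
  rw [integral_multinomialExp m x fun l => integrable_indicator_Iic _]
  simp only [integral_indicator_Iic]

theorem memLp_bernsteinKernel (m : ℕ) (x : Fin d → ℝ) : MemLp (bernsteinKernel m x) 2 μ := by
  rw [memLp_two_iff_integrable_sq (measurable_bernsteinKernel m x).aestronglyMeasurable]
  simp only [bernsteinKernel_sq]
  exact integrable_multinomialExp m x fun k =>
    integrable_multinomialExp m x fun l => integrable_indicator_Iic _

/-- The decomposition of the mean squared error into variance and squared bias. -/
theorem mse_eq {Ω : Type*} [MeasurableSpace Ω] {P : Measure Ω} [IsProbabilityMeasure P]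
    {X : ℕ → Ω → (Fin d → ℝ)} (hlaw : ∀ i, HasLaw (X i) μ P) (hindep : iIndepFun X P) (x : Fin d → ℝ) {n : ℕ}
    (hn : 0 < n) (m : ℕ) :
    mse P X (jointCDF μ) x n m =
      (n : ℝ)⁻¹ * (infMean (jointCDF μ) m x - bernsteinPoly (jointCDF μ) m x ^ 2) +
        (bernsteinPoly (jointCDF μ) m x - jointCDF μ x) ^ 2 := by
  have hn0 : (n : ℝ) ≠ 0 := by positivity
  have hmeas := measurable_bernsteinKernel m x
  set Y : ℕ → Ω → ℝ := fun i => bernsteinKernel m x ∘ X i with hY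
  have hYm (i : ℕ) : MemLp (Y i) 2 P := by
    have h := memLp_bernsteinKernel (μ := μ) m x
    rw [← (hlaw i).map_eq] at h
    exact h.comp_of_map (hlaw i).aemeasurable
  have hYmean (i : ℕ) : ∫ ω, Y i ω ∂P = bernsteinPoly (jointCDF μ) m x := by
    rw [← integral_bernsteinKernel]
    exact (hlaw i).integral_comp hmeas.aestronglyMeasurable
  have hYvar (i : ℕ) : variance (Y i) P =
      infMean (jointCDF μ) m x - bernsteinPoly (jointCDF μ) m x ^ 2 := by
    rw [variance_eq_sub (hYm i), hYmean, ← integral_bernsteinKernel_sq]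
    congr 1
    exact (hlaw i).integral_comp (f := fun z => bernsteinKernel m x z ^ 2)
      (hmeas.pow_const 2).aestronglyMeasurable
  set Z : Ω → ℝ := fun ω => (n : ℝ)⁻¹ * (∑ i ∈ Finset.range n, Y i) ω with hZ
  have hSm : MemLp (∑ i ∈ Finset.range n, Y i) 2 P := memLp_finsetSum' _ fun i _ => hYm i
  have hZm : MemLp Z 2 P := hSm.const_mul _
  have hZvar : variance Z P =
      (n : ℝ)⁻¹ * (infMean (jointCDF μ) m x - bernsteinPoly (jointCDF μ) m x ^ 2) := by
    rw [hZ, variance_const_mul, IndepFun.variance_sum (fun i _ => hYm i) fun i _ j _ hij =>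
      (hindep.indepFun hij).comp hmeas hmeas]
    simp only [hYvar, Finset.sum_const, Finset.card_range, nsmul_eq_mul]
    field_simp
  have hZmean : ∫ ω, Z ω ∂P = bernsteinPoly (jointCDF μ) m x := by
    simp only [hZ, Finset.sum_apply]
    rw [integral_const_mul, integral_finsetSum _ fun i _ => (hYm i).integrable one_le_two]
    simp only [hYmean, Finset.sum_const, Finset.card_range, nsmul_eq_mul]
    field_simp
  have hE (ω : Ω) : bernsteinEstimator X n m x ω = Z ω := by
    simp [bernsteinEstimator_eq, hZ, hY]
  have hv := variance_eq_sub (μ := P) (hZm.sub (memLp_const (jointCDF μ x)))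
  have hv' : variance (Z - fun _ => jointCDF μ x) P = variance Z P :=
    variance_sub_const hZm.aestronglyMeasurable _
  have hint : ∫ ω, (Z - (fun _ => jointCDF μ x : Ω → ℝ)) ω ∂P =
      bernsteinPoly (jointCDF μ) m x - jointCDF μ x := by
    simp only [Pi.sub_apply]
    rw [integral_sub (hZm.integrable one_le_two) (integrable_const _), hZmean]
    simp
  rw [hv', hint, hZvar] at hv
  simp only [Pi.pow_apply, Pi.sub_apply] at hv
  simp only [mse, hE]
  linarith

end MeanSquaredError

/-! ### Asymptotic expansion of the mean squared error. -/

section Expansion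

variable {d : ℕ} {F : (Fin d → ℝ) → ℝ} {x : Fin d → ℝ}

/-- The error of the variance expansion, relative to `n⁻¹ m^{-1/2}`. -/
noncomputable def varianceError (F : (Fin d → ℝ) → ℝ) (x : Fin d → ℝ) (m : ℕ) : ℝ :=
  Real.sqrt m * (infMean F m x - F x) + varCoeff F x -
    Real.sqrt m * (bernsteinPoly F m x - F x) * (bernsteinPoly F m x + F x)

/-- The error of the expansion of the squared bias, relative to `m⁻²`. -/
noncomputable def biasError (F : (Fin d → ℝ) → ℝ) (x : Fin d → ℝ) (m : ℕ) : ℝ :=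
  (m * (bernsteinPoly F m x - F x)) ^ 2 - biasCoeff F x ^ 2

theorem eventually_abs_mul_bias_sub_le (hC2 : ContDiffOn ℝ 2 F (simplex d)) {ε : ℝ} (hε : 0 < ε) :
    ∀ᶠ m : ℕ in atTop, ∀ x ∈ simplexInterior d,
      |m * (bernsteinPoly F m x - F x) - biasCoeff F x| ≤ ε := by
  filter_upwards [eventually_abs_bias_le hC2 hε, eventually_gt_atTop 0] with m hm hm0 x hx
  have h0 : (0 : ℝ) < m := by exact_mod_cast hm0
  have h := mul_le_mul_of_nonneg_left (hm x hx) h0.le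
  rw [← abs_of_pos h0, ← abs_mul, abs_of_pos h0, mul_sub] at h
  rwa [mul_inv_cancel_left₀ h0.ne', mul_left_comm, mul_inv_cancel₀ h0.ne', mul_one] at h

theorem eventually_abs_biasError_le (hC2 : ContDiffOn ℝ 2 F (simplex d)) {ε : ℝ} (hε : 0 < ε) :
    ∀ᶠ m : ℕ in atTop, ∀ x ∈ simplexInterior d, |biasError F x m| ≤ ε := by
  obtain ⟨C, hC0, hC⟩ := exists_biasCoeff_bound hC2
  set η := min 1 (ε / (2 * C + 1)) with hη
  have hη0 : 0 < η := lt_min one_pos (by positivity)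
  have hη1 : η * (2 * C + 1) ≤ ε := (le_div_iff₀ (by positivity)).1 (min_le_right _ _)
  filter_upwards [eventually_abs_mul_bias_sub_le hC2 hη0] with m hm x hx
  have h1 := hm x hx
  have h2 := hC x hx
  rw [biasError, sq_sub_sq, abs_mul]
  have h3 : |m * (bernsteinPoly F m x - F x) + biasCoeff F x| ≤ 2 * C + 1 := by
    have h4 : η ≤ 1 := min_le_left _ _
    rw [abs_le] at h1 h2 ⊢
    constructor <;> linarith [h1.1, h1.2, h2.1, h2.2]
  calc _ ≤ (2 * C + 1) * η := by gcongr
    _ ≤ ε := by linarith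

theorem tendsto_biasError (hC2 : ContDiffOn ℝ 2 F (simplex d)) (hx : x ∈ simplexInterior d) :
    Tendsto (biasError F x) atTop (𝓝 0) := by
  rw [Metric.tendsto_nhds]
  intro ε hε
  filter_upwards [eventually_abs_biasError_le hC2 (half_pos hε)] with m hm
  rw [Real.dist_0_eq_abs]
  exact (hm x hx).trans_lt (half_lt_self hε)

/-- With `b_m` the Bernstein polynomial, replacing `F²` by `b_m²` in the variance costs `(b_m -
F)(b_m + F) = O(1/m)`, which is still negligible after multiplication by `√m`. -/
theorem tendsto_varianceError (hC2 : ContDiffOn ℝ 2 F (simplex d)) (hx : x ∈ simplexInterior d) :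
    Tendsto (varianceError F x) atTop (𝓝 0) := by
  have h1 := tendsto_sqrt_mul_infMean_sub hC2 hx
  have h2 : Tendsto (fun m : ℕ => m * (bernsteinPoly F m x - F x)) atTop (𝓝 (biasCoeff F x)) := by
    rw [Metric.tendsto_nhds]
    intro ε hε
    filter_upwards [eventually_abs_mul_bias_sub_le hC2 (half_pos hε)] with m hm
    exact (hm x hx).trans_lt (half_lt_self hε)
  have h3 : Tendsto (fun m : ℕ => Real.sqrt m * (bernsteinPoly F m x - F x)) atTop (𝓝 0) := by
    have h := tendsto_sqrt_mul_inv.mul h2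
    rw [zero_mul] at h
    refine h.congr' ?_
    filter_upwards [eventually_gt_atTop 0] with m hm
    have : (m : ℝ) ≠ 0 := by positivity
    field_simp
  have h4 : Tendsto (fun m : ℕ => bernsteinPoly F m x + F x) atTop (𝓝 (2 * F x)) := by
    have h := (tendsto_natCast_atTop_atTop (R := ℝ)).inv_tendsto_atTop.mul h2
    rw [zero_mul] at h
    have h5 := h.add_const (2 * F x)
    rw [zero_add] at h5
    refine h5.congr' ?_
    filter_upwards [eventually_gt_atTop 0] with m hm
    have : (m : ℝ) ≠ 0 := by positivity
    simp only [Pi.inv_apply]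
    field_simp
    ring
  have h := (h1.add_const (varCoeff F x)).sub (h3.mul h4)
  simp only [neg_add_cancel, zero_mul, sub_zero] at h
  exact h

variable {Ω : Type*} [MeasurableSpace Ω] {P : Measure Ω} [IsProbabilityMeasure P]
  {μ : Measure (Fin d → ℝ)} [IsProbabilityMeasure μ] {X : ℕ → Ω → (Fin d → ℝ)}

/-- An exact identity; all asymptotics are confined to two error functions that depend on `m` but
not on `n`. -/
theorem mse_expansion (hlaw : ∀ i, HasLaw (X i) μ P) (hindep : iIndepFun X P)
    (hF : F = jointCDF μ) (x : Fin d → ℝ) {n m : ℕ} (hn : 0 < n) (hm : 0 < m) :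
    mse P X F x n m = (n : ℝ)⁻¹ * sigmaSq F x +
      (n : ℝ)⁻¹ * (Real.sqrt m)⁻¹ * (-varCoeff F x + varianceError F x m) +
      ((m : ℝ) ^ 2)⁻¹ * (biasCoeff F x ^ 2 + biasError F x m) := by
  have h1 : Real.sqrt m ≠ 0 := by positivity
  have h2 : (m : ℝ) ≠ 0 := by positivity
  have h3 : (n : ℝ) ≠ 0 := by positivity
  subst hF
  rw [mse_eq hlaw hindep x hn, sigmaSq, varianceError, biasError]
  field_simp
  ring

/-- A c.d.f. is monotone in each coordinate. This fixes the sign of `V`, so that `V ≠ 0` yields a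
genuine minimum. -/
theorem varCoeff_nonneg (hF : F = jointCDF μ) (x : Fin d → ℝ) : 0 ≤ varCoeff F x := by
  have hmono : Monotone F := by
    subst hF
    exact fun y z hyz => measureReal_mono (Set.Iic_subset_Iic.2 hyz)
  refine Finset.sum_nonneg fun i _ => mul_nonneg ?_ (Real.sqrt_nonneg _)
  rw [partialDeriv, lineDeriv]
  refine Monotone.deriv_nonneg (fun s t hst => hmono ?_)
  refine add_le_add_right (smul_le_smul_of_nonneg_right hst ?_) x
  exact Pi.single_nonneg.2 zero_le_one

end Expansion

/-! ### Stability of the minimum of a perturbed quartic. -/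

section Quartic

variable {V b s₀ : ℝ}

/-- The rescaled leading part of the mean squared error. -/
def quartic (V b s : ℝ) : ℝ := -V * s + b * s ^ 4

/-- The hypothesis says that `s₀` is a critical point, hence a double root of the difference. -/
theorem quartic_sub (h : 4 * b * s₀ ^ 3 = V) (s : ℝ) :
    quartic V b s - quartic V b s₀ = b * (s - s₀) ^ 2 * (s ^ 2 + 2 * s * s₀ + 3 * s₀ ^ 2) := by
  subst h
  simp only [quartic]
  ring

theorem mul_sq_sub_le_quartic_sub (hb : 0 < b) (hs₀ : 0 < s₀) (h : 4 * b * s₀ ^ 3 = V) {s : ℝ}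
    (hs : 0 ≤ s) : 3 * b * s₀ ^ 2 * (s - s₀) ^ 2 ≤ quartic V b s - quartic V b s₀ := by
  rw [quartic_sub h]
  have : 0 ≤ b * (s - s₀) ^ 2 * (s ^ 2 + 2 * s * s₀) := by positivity
  nlinarith

/-- Coercivity: perturbations proportional to `s` and `s⁴` can be measured by the excess over the
minimum, so `s` need not be known to be bounded. -/
theorem exists_add_pow_four_le (hb : 0 < b) (hs₀ : 0 < s₀) (h : 4 * b * s₀ ^ 3 = V) :
    ∃ C, 0 < C ∧ ∀ s, 0 ≤ s →
      s + s ^ 4 ≤ C * (1 + (quartic V b s - quartic V b s₀)) := by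
  refine ⟨1 + 8 / b + 2 * s₀ + 16 * s₀ ^ 4, by positivity, fun s hs => ?_⟩
  have hD := mul_sq_sub_le_quartic_sub hb hs₀ h hs
  -- For `s ≤ 2s₀` the constants `2s₀` and `16s₀⁴` suffice. For `s ≥ 2s₀` the excess is at least `b
  -- s⁴/4`, and `s + s⁴ ≤ 1 + 2s⁴` explains `8/b`.
  have hD0 : 0 ≤ quartic V b s - quartic V b s₀ := le_trans (by positivity) hD
  rcases le_total s (2 * s₀) with hle | hle
  · have h4 : s ^ 4 ≤ (2 * s₀) ^ 4 := by gcongr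
    have h8 : 0 < 8 / b := by positivity
    have : 0 ≤ (1 + 8 / b + 2 * s₀ + 16 * s₀ ^ 4) * (quartic V b s - quartic V b s₀) := by
      positivity
    nlinarith
  · have h1 : b * s ^ 4 / 4 ≤ quartic V b s - quartic V b s₀ := by
      rw [quartic_sub h]
      have h2 : s ^ 2 / 4 ≤ (s - s₀) ^ 2 := by nlinarith
      calc _ = b * (s ^ 2 / 4) * s ^ 2 := by ring
        _ ≤ b * (s - s₀) ^ 2 * (s ^ 2 + 2 * s * s₀ + 3 * s₀ ^ 2) := by
          gcongr
          nlinarith [mul_nonneg hs hs₀.le, sq_nonneg s₀]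
    have h3 : 2 * s ^ 4 ≤ 8 / b * (quartic V b s - quartic V b s₀) := by
      rw [div_mul_eq_mul_div, le_div_iff₀ hb]
      linarith
    have h4 : s ≤ 1 + s ^ 4 := by nlinarith [sq_nonneg (s - 1), sq_nonneg (s ^ 2 - 1 / 2)]
    have h5 : 0 ≤ (1 + 2 * s₀ + 16 * s₀ ^ 4) * (quartic V b s - quartic V b s₀) := by positivity
    have h6 : 0 ≤ 8 / b + 2 * s₀ + 16 * s₀ ^ 4 := by positivity
    nlinarith

variable {s e₁ e₂ : ℕ → ℝ}

theorem eventually_abs_perturbation_le (hb : 0 < b) (hs₀ : 0 < s₀) (h : 4 * b * s₀ ^ 3 = V)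
    (hs : ∀ n, 0 ≤ s n) (h₁ : Tendsto e₁ atTop (𝓝 0)) (h₂ : Tendsto e₂ atTop (𝓝 0)) {ε : ℝ}
    (hε : 0 < ε) :
    ∀ᶠ n in atTop, |e₁ n * s n + e₂ n * s n ^ 4| ≤
      ε * (1 + (quartic V b (s n) - quartic V b s₀)) := by
  obtain ⟨C, hC0, hC⟩ := exists_add_pow_four_le hb hs₀ h
  have hη : 0 < ε / C := by positivity
  filter_upwards [Metric.tendsto_nhds.1 h₁ _ hη, Metric.tendsto_nhds.1 h₂ _ hη] with n hn1 hn2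
  rw [Real.dist_0_eq_abs] at hn1 hn2
  have hsn := hs n
  calc _ ≤ |e₁ n| * s n + |e₂ n| * s n ^ 4 := by
        refine (abs_add_le _ _).trans ?_
        rw [abs_mul, abs_mul, abs_of_nonneg hsn, abs_of_nonneg (pow_nonneg hsn 4)]
    _ ≤ ε / C * s n + ε / C * s n ^ 4 := by gcongr
    _ = ε / C * (s n + s n ^ 4) := by ring
    _ ≤ ε / C * (C * (1 + (quartic V b (s n) - quartic V b s₀))) := by
        gcongr
        exact hC _ hsn
    _ = _ := by field_simp

theorem eventually_quartic_sub_le_perturbation (hb : 0 < b) (hs₀ : 0 < s₀)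
    (h : 4 * b * s₀ ^ 3 = V) (hs : ∀ n, 0 ≤ s n) (h₁ : Tendsto e₁ atTop (𝓝 0))
    (h₂ : Tendsto e₂ atTop (𝓝 0)) {ε : ℝ} (hε : 0 < ε) :
    ∀ᶠ n in atTop, quartic V b s₀ - ε ≤ quartic V b (s n) + (e₁ n * s n + e₂ n * s n ^ 4) := by
  filter_upwards [eventually_abs_perturbation_le hb hs₀ h hs h₁ h₂ (lt_min hε one_pos)] with n hn
  have hD : 0 ≤ quartic V b (s n) - quartic V b s₀ :=
    le_trans (by positivity) (mul_sq_sub_le_quartic_sub hb hs₀ h (hs n))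
  have h3 := (abs_le.1 hn).1
  have h4 := min_le_left ε 1
  have h5 := min_le_right ε 1
  nlinarith

theorem tendsto_of_perturbation_le (hb : 0 < b) (hs₀ : 0 < s₀) (h : 4 * b * s₀ ^ 3 = V)
    (hs : ∀ n, 0 ≤ s n) (h₁ : Tendsto e₁ atTop (𝓝 0)) (h₂ : Tendsto e₂ atTop (𝓝 0))
    (hle : ∀ ε : ℝ, 0 < ε → ∀ᶠ n in atTop,
      quartic V b (s n) + (e₁ n * s n + e₂ n * s n ^ 4) ≤ quartic V b s₀ + ε) :
    Tendsto s atTop (𝓝 s₀) := by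
  have hD : Tendsto (fun n => quartic V b (s n) - quartic V b s₀) atTop (𝓝 0) := by
    rw [Metric.tendsto_nhds]
    intro ε hε
    -- With `D` the excess and `η` this minimum, the two bounds give `D ≤ η + η(1 + D)`; as `η ≤
    -- 1/2`, it follows that `D ≤ 4η < ε`.
    have hη : 0 < min (ε / 5) (1 / 2) := lt_min (by positivity) (by norm_num)
    filter_upwards [hle _ hη, eventually_abs_perturbation_le hb hs₀ h hs h₁ h₂ hη] with n hn1 hn2
    have hD : 0 ≤ quartic V b (s n) - quartic V b s₀ :=
      le_trans (by positivity) (mul_sq_sub_le_quartic_sub hb hs₀ h (hs n))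
    rw [Real.dist_0_eq_abs, abs_of_nonneg hD]
    have h3 := (abs_le.1 hn2).1
    have h4 := min_le_left (ε / 5) (1 / 2)
    have h5 := min_le_right (ε / 5) (1 / 2)
    nlinarith
  have hsq : Tendsto (fun n => (s n - s₀) ^ 2) atTop (𝓝 0) := by
    have h3 := hD.const_mul (3 * b * s₀ ^ 2)⁻¹
    rw [mul_zero] at h3
    refine squeeze_zero (fun n => sq_nonneg _) (fun n => ?_) h3
    rw [inv_mul_eq_div, le_div_iff₀ (by positivity), mul_comm]
    exact mul_sq_sub_le_quartic_sub hb hs₀ h (hs n)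
  have h4 := (Real.continuous_sqrt.tendsto _).comp hsq
  simp only [Function.comp_def, Real.sqrt_sq_eq_abs, Real.sqrt_zero] at h4
  exact tendsto_sub_nhds_zero_iff.1 ((tendsto_zero_iff_abs_tendsto_zero _).2 h4)

theorem tendsto_perturbation (h₁ : Tendsto e₁ atTop (𝓝 0)) (h₂ : Tendsto e₂ atTop (𝓝 0))
    (hs : Tendsto s atTop (𝓝 s₀)) :
    Tendsto (fun n => quartic V b (s n) + (e₁ n * s n + e₂ n * s n ^ 4)) atTop
      (𝓝 (quartic V b s₀)) := by
  have h := ((hs.const_mul (-V)).add ((hs.pow 4).const_mul b)).add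
    ((h₁.mul hs).add (h₂.mul (hs.pow 4)))
  simpa [quartic] using h

end Quartic

/-! ### Rescaling the bandwidth. -/

section Bandwidth

/-- The bandwidth `t` on the scale on which the leading part of the mean squared error is a
quartic polynomial. -/
noncomputable def rescale (n : ℕ) (t : ℝ) : ℝ := (n : ℝ) ^ (1 / 3 : ℝ) / Real.sqrt t

theorem rescale_nonneg (n : ℕ) (t : ℝ) : 0 ≤ rescale n t := by
  unfold rescale
  positivity

theorem inv_mul_inv_sqrt_eq {n : ℕ} (hn : 0 < n) (t : ℝ) :
    (n : ℝ)⁻¹ * (Real.sqrt t)⁻¹ = (n : ℝ) ^ (-(4 / 3) : ℝ) * rescale n t := by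
  have hn0 : (0 : ℝ) < n := by exact_mod_cast hn
  rw [rescale, ← mul_div_assoc, ← Real.rpow_add hn0, div_eq_mul_inv, ← Real.rpow_neg_one]
  norm_num

theorem inv_sq_eq {n : ℕ} (hn : 0 < n) {t : ℝ} (ht : 0 ≤ t) :
    (t ^ 2)⁻¹ = (n : ℝ) ^ (-(4 / 3) : ℝ) * rescale n t ^ 4 := by
  have hn0 : (0 : ℝ) < n := by exact_mod_cast hn
  have h1 : Real.sqrt t ^ 4 = t ^ 2 := by
    rw [show 4 = 2 * 2 by norm_num, pow_mul, Real.sq_sqrt ht]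
  have h2 : (n : ℝ) ^ (-(4 / 3) : ℝ) * ((n : ℝ) ^ (1 / 3 : ℝ)) ^ 4 = 1 := by
    rw [← Real.rpow_natCast, ← Real.rpow_mul hn0.le, ← Real.rpow_add hn0]
    norm_num
  rw [rescale, div_pow, h1, ← mul_div_assoc, h2, one_div]

variable {d : ℕ} {F : (Fin d → ℝ) → ℝ} {x : Fin d → ℝ}

/-- The rescaled optimal bandwidth. -/
noncomputable def rescaledOpt (F : (Fin d → ℝ) → ℝ) (x : Fin d → ℝ) : ℝ :=
  (varCoeff F x / (4 * biasCoeff F x ^ 2)) ^ (1 / 3 : ℝ)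

theorem rescaledOpt_pos (hV : 0 < varCoeff F x) (hB : biasCoeff F x ≠ 0) :
    0 < rescaledOpt F x := by
  unfold rescaledOpt
  positivity

theorem rescaledOpt_cube (hV : 0 < varCoeff F x) (hB : biasCoeff F x ≠ 0) :
    4 * biasCoeff F x ^ 2 * rescaledOpt F x ^ 3 = varCoeff F x := by
  have h : 0 ≤ varCoeff F x / (4 * biasCoeff F x ^ 2) := by positivity
  rw [rescaledOpt, ← Real.rpow_mul_natCast h]
  norm_num
  field_simp

/-- At the critical point `B² s₀⁴ = V s₀/4`, so the minimum is `-(3/4) V s₀`. -/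
theorem quartic_rescaledOpt (hV : 0 < varCoeff F x) (hB : biasCoeff F x ≠ 0) :
    quartic (varCoeff F x) (biasCoeff F x ^ 2) (rescaledOpt F x) =
      -(3 / 4 * (varCoeff F x ^ 4 / (4 * biasCoeff F x ^ 2)) ^ (1 / 3 : ℝ)) := by
  have h := rescaledOpt_cube hV hB
  have hs := rescaledOpt_pos hV hB
  have h1 : varCoeff F x ^ 4 / (4 * biasCoeff F x ^ 2) =
      (varCoeff F x * rescaledOpt F x) ^ 3 := by
    rw [div_eq_iff (by positivity), mul_pow]
    linear_combination (-varCoeff F x ^ 3) * h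
  have h2 : 0 ≤ varCoeff F x * rescaledOpt F x := by positivity
  rw [h1, ← Real.rpow_natCast_mul h2, quartic]
  norm_num
  linear_combination (1 / 4 * rescaledOpt F x) * h

theorem mOpt_pos (hV : 0 < varCoeff F x) (hB : biasCoeff F x ≠ 0) {n : ℕ} (hn : 0 < n) :
    0 < mOpt F x n := by
  unfold mOpt
  positivity

theorem rescale_mOpt (hV : 0 < varCoeff F x) (hB : biasCoeff F x ≠ 0) {n : ℕ} (hn : 0 < n) :
    rescale n (mOpt F x n) = rescaledOpt F x := by
  have h0 : 0 ≤ 4 * biasCoeff F x ^ 2 / varCoeff F x := by positivity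
  have hn0 : (0 : ℝ) < n := by exact_mod_cast hn
  have h1 : mOpt F x n =
      ((n : ℝ) ^ (1 / 3 : ℝ) * (4 * biasCoeff F x ^ 2 / varCoeff F x) ^ (1 / 3 : ℝ)) ^ 2 := by
    rw [mOpt, mul_pow, ← Real.rpow_mul_natCast hn0.le, ← Real.rpow_mul_natCast h0]
    norm_num
  have h2 : 0 < (n : ℝ) ^ (1 / 3 : ℝ) := by positivity
  rw [rescale, h1, Real.sqrt_sq (by positivity), rescaledOpt, ← div_div, div_self h2.ne', one_div,
    ← Real.inv_rpow h0, inv_div]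

theorem rescale_eq (hV : 0 < varCoeff F x) (hB : biasCoeff F x ≠ 0) {n : ℕ} (hn : 0 < n) {t : ℝ}
    (ht : 0 ≤ t) : rescale n t = rescaledOpt F x / Real.sqrt (t / mOpt F x n) := by
  have h := mOpt_pos hV hB hn
  have h2 : Real.sqrt (mOpt F x n) ≠ 0 := by positivity
  rw [← rescale_mOpt hV hB hn, rescale, rescale, Real.sqrt_div ht]
  field_simp

theorem leadingMSE_eq {n : ℕ} (hn : 0 < n) {t : ℝ} (ht : 0 < t) :
    leadingMSE F x n t = (n : ℝ)⁻¹ * sigmaSq F x + (n : ℝ) ^ (-(4 / 3) : ℝ) *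
      quartic (varCoeff F x) (biasCoeff F x ^ 2) (rescale n t) := by
  rw [leadingMSE, Real.rpow_neg ht.le, ← Real.sqrt_eq_rpow, inv_mul_inv_sqrt_eq hn,
    inv_sq_eq hn ht.le, quartic]
  ring

theorem leadingMSE_mOpt_lt (hV : 0 < varCoeff F x) (hB : biasCoeff F x ≠ 0) {n : ℕ} (hn : 0 < n)
    {t : ℝ} (ht : 0 < t) (hne : t ≠ mOpt F x n) :
    leadingMSE F x n (mOpt F x n) < leadingMSE F x n t := by
  have h := mOpt_pos hV hB hn
  have hn0 : (0 : ℝ) < n := by exact_mod_cast hn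
  have hs := rescaledOpt_pos hV hB
  rw [leadingMSE_eq hn ht, leadingMSE_eq hn h, rescale_mOpt hV hB hn]
  gcongr
  have h1 : rescale n t - rescaledOpt F x ≠ 0 := by
    rw [sub_ne_zero, rescale_eq hV hB hn ht.le]
    intro h2
    rw [div_eq_iff (by positivity), eq_comm, mul_eq_left₀ hs.ne', Real.sqrt_eq_one,
      div_eq_one_iff_eq h.ne'] at h2
    exact hne h2
  have h2 := mul_sq_sub_le_quartic_sub (b := biasCoeff F x ^ 2) (by positivity) hs
    (rescaledOpt_cube hV hB) (rescale_nonneg n t)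
  have h3 : 0 < 3 * biasCoeff F x ^ 2 * rescaledOpt F x ^ 2 *
    (rescale n t - rescaledOpt F x) ^ 2 := by positivity
  linarith

/-- The ratio `m/m_opt` equals `(s₀/s)²`, so it tends to 1 exactly when `s` tends to `s₀`. -/
theorem isEquivalent_mOpt_iff (hV : 0 < varCoeff F x) (hB : biasCoeff F x ≠ 0) {m : ℕ → ℕ} :
    (fun n : ℕ => (m n : ℝ)) ~[atTop] mOpt F x ↔
      Tendsto (fun n => rescale n (m n)) atTop (𝓝 (rescaledOpt F x)) := by
  have hs := rescaledOpt_pos hV hB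
  have hpos : ∀ᶠ n : ℕ in atTop, 0 < mOpt F x n := by
    filter_upwards [eventually_gt_atTop 0] with n hn using mOpt_pos hV hB hn
  rw [isEquivalent_iff_tendsto_one (hpos.mono fun n hn => hn.ne')]
  constructor
  · intro h
    have h1 := (tendsto_const_nhds (x := rescaledOpt F x)).div
      ((Real.continuous_sqrt.tendsto _).comp h) (by simp)
    rw [Real.sqrt_one, div_one] at h1
    refine h1.congr' ?_
    filter_upwards [eventually_gt_atTop 0] with n hn
    rw [rescale_eq hV hB hn (Nat.cast_nonneg _)]
    rfl
  · intro h
    have h1 := ((tendsto_const_nhds (x := rescaledOpt F x)).div h hs.ne').pow 2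
    rw [div_self hs.ne', one_pow] at h1
    refine h1.congr' ?_
    filter_upwards [eventually_gt_atTop 0] with n hn
    have h2 : 0 ≤ (m n : ℝ) / mOpt F x n := div_nonneg (Nat.cast_nonneg _) (mOpt_pos hV hB hn).le
    simp only [Pi.div_apply]
    rw [rescale_eq hV hB hn (Nat.cast_nonneg _), div_div_cancel₀ hs.ne', Real.sq_sqrt h2]

theorem tendsto_mOpt (hV : 0 < varCoeff F x) (hB : biasCoeff F x ≠ 0) :
    Tendsto (mOpt F x) atTop atTop := by
  have h0 : 0 < (4 * biasCoeff F x ^ 2 / varCoeff F x) ^ (2 / 3 : ℝ) := by positivity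
  exact ((tendsto_rpow_atTop (by norm_num)).comp tendsto_natCast_atTop_atTop).atTop_mul_const h0

theorem tendsto_of_isEquivalent_mOpt (hV : 0 < varCoeff F x) (hB : biasCoeff F x ≠ 0) {m : ℕ → ℕ}
    (h : (fun n : ℕ => (m n : ℝ)) ~[atTop] mOpt F x) : Tendsto m atTop atTop :=
  tendsto_natCast_atTop_iff.1 (h.symm.tendsto_atTop (tendsto_mOpt hV hB))

/-- Supplies an integer competitor that attains the minimum of the quartic in the limit. -/
theorem isEquivalent_ceil_mOpt (hV : 0 < varCoeff F x) (hB : biasCoeff F x ≠ 0) :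
    (fun n : ℕ => ((⌈mOpt F x n⌉₊ : ℕ) : ℝ)) ~[atTop] mOpt F x := by
  have h := tendsto_mOpt hV hB
  rw [isEquivalent_iff_tendsto_one ((h.eventually_gt_atTop 0).mono fun n hn => hn.ne')]
  exact tendsto_nat_ceil_div_atTop.comp h

end Bandwidth

/-! ### Asymptotic optimality and the final expansions. -/

section Optimality

variable {d : ℕ} {F : (Fin d → ℝ) → ℝ} {x : Fin d → ℝ} {Ω : Type*} [MeasurableSpace Ω]
  {P : Measure Ω} [IsProbabilityMeasure P] {μ : Measure (Fin d → ℝ)} [IsProbabilityMeasure μ]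
  {X : ℕ → Ω → (Fin d → ℝ)}

/-- The rescaled mean squared error, up to the leading term `n⁻¹ σ²(x)`. -/
noncomputable def rescaledMSE (F : (Fin d → ℝ) → ℝ) (x : Fin d → ℝ) (n m : ℕ) : ℝ :=
  quartic (varCoeff F x) (biasCoeff F x ^ 2) (rescale n m) +
    (varianceError F x m * rescale n m + biasError F x m * rescale n m ^ 4)

theorem mse_eq_rescaledMSE (hlaw : ∀ i, HasLaw (X i) μ P) (hindep : iIndepFun X P)
    (hF : F = jointCDF μ) (x : Fin d → ℝ) {n m : ℕ} (hn : 0 < n) (hm : 0 < m) :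
    mse P X F x n m = (n : ℝ)⁻¹ * sigmaSq F x +
      (n : ℝ) ^ (-(4 / 3) : ℝ) * rescaledMSE F x n m := by
  rw [mse_expansion hlaw hindep hF x hn hm, inv_mul_inv_sqrt_eq hn, inv_sq_eq hn (Nat.cast_nonneg m),
    rescaledMSE, quartic]
  ring

theorem tendsto_rescaledMSE (hC2 : ContDiffOn ℝ 2 F (simplex d)) (hx : x ∈ simplexInterior d)
    (hV : 0 < varCoeff F x) (hB : biasCoeff F x ≠ 0) {m : ℕ → ℕ}
    (h : (fun n : ℕ => (m n : ℝ)) ~[atTop] mOpt F x) :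
    Tendsto (fun n => rescaledMSE F x n (m n)) atTop
      (𝓝 (quartic (varCoeff F x) (biasCoeff F x ^ 2) (rescaledOpt F x))) := by
  have hm := tendsto_of_isEquivalent_mOpt hV hB h
  exact tendsto_perturbation ((tendsto_varianceError hC2 hx).comp hm)
    ((tendsto_biasError hC2 hx).comp hm) ((isEquivalent_mOpt_iff hV hB).1 h)

/-- An optimal sequence is compared with the rounded `mOpt`, which makes its rescaled error nearly
minimal and forces `s → s₀`. Conversely, every competitor tending to infinity stays above the
quartic minimum up to `o(1)`. -/
theorem isAsymptoticallyOptimal_iff (hlaw : ∀ i, HasLaw (X i) μ P) (hindep : iIndepFun X P)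
    (hF : F = jointCDF μ) (hC2 : ContDiffOn ℝ 2 F (simplex d)) (hx : x ∈ simplexInterior d)
    (hV : 0 < varCoeff F x) (hB : biasCoeff F x ≠ 0) (m : ℕ → ℕ) :
    IsAsymptoticallyOptimal (mse P X F x) (fun n : ℕ => (n : ℝ) ^ (-(4 / 3) : ℝ)) m ↔
      (fun n : ℕ => (m n : ℝ)) ~[atTop] mOpt F x := by
  have hB2 : 0 < biasCoeff F x ^ 2 := by positivity
  have hs := rescaledOpt_pos hV hB
  have hcube := rescaledOpt_cube hV hB
  have key {a b : ℕ → ℕ} (ha : Tendsto a atTop atTop) (hb : Tendsto b atTop atTop) (ε : ℝ) :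
      (∀ᶠ n : ℕ in atTop, mse P X F x n (a n) ≤ mse P X F x n (b n) +
        ε * (n : ℝ) ^ (-(4 / 3) : ℝ)) ↔
      ∀ᶠ n : ℕ in atTop, rescaledMSE F x n (a n) ≤ rescaledMSE F x n (b n) + ε := by
    refine eventually_congr ?_
    filter_upwards [eventually_gt_atTop 0, ha.eventually_gt_atTop 0, hb.eventually_gt_atTop 0]
      with n hn han hbn
    have hn0 : (0 : ℝ) < n := by exact_mod_cast hn
    have hr : 0 < (n : ℝ) ^ (-(4 / 3) : ℝ) := by positivity
    rw [mse_eq_rescaledMSE hlaw hindep hF x hn han, mse_eq_rescaledMSE hlaw hindep hF x hn hbn,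
      add_assoc, add_le_add_iff_left, mul_comm ε, ← mul_add, mul_le_mul_iff_right₀ hr]
  constructor
  · rintro ⟨hm, hopt⟩
    have hceil := isEquivalent_ceil_mOpt hV hB
    have hm' := tendsto_of_isEquivalent_mOpt hV hB hceil
    have hlim := tendsto_rescaledMSE hC2 hx hV hB hceil
    refine (isEquivalent_mOpt_iff hV hB).2 (tendsto_of_perturbation_le hB2 hs hcube
      (fun n => rescale_nonneg n _) ((tendsto_varianceError hC2 hx).comp hm)
      ((tendsto_biasError hC2 hx).comp hm) fun ε hε => ?_)
    filter_upwards [(key hm hm' _).1 (hopt _ hm' (ε / 2) (half_pos hε)),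
      hlim.eventually_le_const (lt_add_of_pos_right _ (half_pos hε))] with n h1 h2
    change rescaledMSE F x n (m n) ≤ _
    linarith
  · intro h
    have hm := tendsto_of_isEquivalent_mOpt hV hB h
    refine ⟨hm, fun m' hm' ε hε => (key hm hm' ε).2 ?_⟩
    filter_upwards [eventually_quartic_sub_le_perturbation hB2 hs hcube
      (fun n => rescale_nonneg n _) ((tendsto_varianceError hC2 hx).comp hm')
      ((tendsto_biasError hC2 hx).comp hm') (half_pos hε),
      (tendsto_rescaledMSE hC2 hx hV hB h).eventually_le_const
        (lt_add_of_pos_right _ (half_pos hε))] with n h1 h2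
    change _ ≤ rescaledMSE F x n (m' n) at h1
    linarith

theorem isLittleO_mse_sub (hlaw : ∀ i, HasLaw (X i) μ P) (hindep : iIndepFun X P)
    (hF : F = jointCDF μ) (hC2 : ContDiffOn ℝ 2 F (simplex d)) (hx : x ∈ simplexInterior d)
    (hV : 0 < varCoeff F x) (hB : biasCoeff F x ≠ 0) {m : ℕ → ℕ}
    (h : (fun n : ℕ => (m n : ℝ)) ~[atTop] mOpt F x) :
    (fun n : ℕ => mse P X F x n (m n) - ((n : ℝ)⁻¹ * sigmaSq F x -
      (n : ℝ) ^ (-(4 / 3) : ℝ) * (3 / 4) *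
        (varCoeff F x ^ 4 / (4 * biasCoeff F x ^ 2)) ^ (1 / 3 : ℝ)))
      =o[atTop] fun n : ℕ => (n : ℝ) ^ (-(4 / 3) : ℝ) := by
  have hlim := tendsto_rescaledMSE hC2 hx hV hB h
  have h1 := (isLittleO_one_iff ℝ).2 (tendsto_sub_nhds_zero_iff.2 hlim)
  refine ((isBigO_refl (fun n : ℕ => (n : ℝ) ^ (-(4 / 3) : ℝ)) atTop).mul_isLittleO
    h1).congr' ?_ (by simp)
  filter_upwards [eventually_gt_atTop 0,
    (tendsto_of_isEquivalent_mOpt hV hB h).eventually_gt_atTop 0] with n hn hm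
  rw [mse_eq_rescaledMSE hlaw hindep hF x hn hm, quartic_rescaledOpt hV hB]
  ring

theorem exists_mse_remainders (hlaw : ∀ i, HasLaw (X i) μ P) (hindep : iIndepFun X P)
    (hF : F = jointCDF μ) (hC2 : ContDiffOn ℝ 2 F (simplex d)) {m : ℕ → ℕ}
    (hm : Tendsto m atTop atTop) :
    ∃ r₁ r₂ : (Fin d → ℝ) → ℕ → ℝ,
      (∀ x ∈ simplexInterior d, ∀ n : ℕ,
        mse P X F x n (m n) = (n : ℝ)⁻¹ * sigmaSq F x
          - (n : ℝ)⁻¹ * (m n : ℝ) ^ (-(1 / 2) : ℝ) * varCoeff F x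
          + ((m n : ℝ) ^ 2)⁻¹ * biasCoeff F x ^ 2 + r₁ x n + r₂ x n) ∧
      (∀ x ∈ simplexInterior d,
        r₁ x =o[atTop] fun n : ℕ => (n : ℝ)⁻¹ * (m n : ℝ) ^ (-(1 / 2) : ℝ)) ∧
      (∀ ε : ℝ, 0 < ε → ∀ᶠ n in atTop, ∀ x ∈ simplexInterior d,
        |r₂ x n| ≤ ε * ((m n : ℝ) ^ 2)⁻¹) := by
  -- `r₁` is whatever remains, so the identity holds for every `n`, even where `n` or `m n` is zero;
  -- it equals the variance error once both are positive. `r₂` carries the uniformly small bias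
  -- error.
  refine ⟨fun x n => mse P X F x n (m n) - ((n : ℝ)⁻¹ * sigmaSq F x
      - (n : ℝ)⁻¹ * (m n : ℝ) ^ (-(1 / 2) : ℝ) * varCoeff F x
      + ((m n : ℝ) ^ 2)⁻¹ * biasCoeff F x ^ 2 + ((m n : ℝ) ^ 2)⁻¹ * biasError F x (m n)),
    fun x n => ((m n : ℝ) ^ 2)⁻¹ * biasError F x (m n), fun x _ n => by ring, fun x hx => ?_,
    fun ε hε => ?_⟩
  · have h1 := (isLittleO_one_iff ℝ).2 ((tendsto_varianceError hC2 hx).comp hm)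
    refine ((isBigO_refl (fun n : ℕ => (n : ℝ)⁻¹ * (m n : ℝ) ^ (-(1 / 2) : ℝ))
      atTop).mul_isLittleO h1).congr' ?_ (by simp)
    filter_upwards [eventually_gt_atTop 0, hm.eventually_gt_atTop 0] with n hn hmn
    rw [mse_expansion hlaw hindep hF x hn hmn, Real.rpow_neg (Nat.cast_nonneg _),
      ← Real.sqrt_eq_rpow, Function.comp]
    ring
  · filter_upwards [hm.eventually (eventually_abs_biasError_le hC2 hε)] with n hn x hx
    rw [abs_mul, abs_of_nonneg (by positivity), mul_comm]
    gcongr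
    exact hn x hx

end Optimality

end BernsteinSimplex

theorem mainTheorem12 {d : ℕ} {Ω : Type*} [MeasurableSpace Ω] (P : Measure Ω)
    [IsProbabilityMeasure P] (μ : Measure (Fin d → ℝ)) [IsProbabilityMeasure μ]
    (X : ℕ → Ω → (Fin d → ℝ)) (hlaw : ∀ i, HasLaw (X i) μ P) (hindep : iIndepFun X P)
    (F : (Fin d → ℝ) → ℝ) (hF : F = BernsteinSimplex.jointCDF μ)
    (hC2 : ContDiffOn ℝ 2 F (BernsteinSimplex.simplex d)) :
    -- the expansion: the first remainder is pointwise in `x`, the second one uniform in `x`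
    (∀ m : ℕ → ℕ, Tendsto m atTop atTop →
      ∃ r₁ r₂ : (Fin d → ℝ) → ℕ → ℝ,
        (∀ x ∈ BernsteinSimplex.simplexInterior d, ∀ n : ℕ,
          BernsteinSimplex.mse P X F x n (m n) =
            (n : ℝ)⁻¹ * BernsteinSimplex.sigmaSq F x
              - (n : ℝ)⁻¹ * (m n : ℝ) ^ (-(1 / 2) : ℝ) * BernsteinSimplex.varCoeff F x
              + ((m n : ℝ) ^ 2)⁻¹ * BernsteinSimplex.biasCoeff F x ^ 2
              + r₁ x n + r₂ x n) ∧
        (∀ x ∈ BernsteinSimplex.simplexInterior d,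
          r₁ x =o[atTop] fun n : ℕ => (n : ℝ)⁻¹ * (m n : ℝ) ^ (-(1 / 2) : ℝ)) ∧
        (∀ ε : ℝ, 0 < ε → ∀ᶠ n in atTop, ∀ x ∈ BernsteinSimplex.simplexInterior d,
          |r₂ x n| ≤ ε * ((m n : ℝ) ^ 2)⁻¹)) ∧
    (∀ x ∈ BernsteinSimplex.simplexInterior d,
      BernsteinSimplex.varCoeff F x * BernsteinSimplex.biasCoeff F x ≠ 0 →
      -- `mOpt` is the unique minimizer of the leading part of the mean squared error
      (∀ n : ℕ, 1 ≤ n → 0 < BernsteinSimplex.mOpt F x n ∧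
        ∀ t : ℝ, 0 < t → t ≠ BernsteinSimplex.mOpt F x n →
          BernsteinSimplex.leadingMSE F x n (BernsteinSimplex.mOpt F x n) <
            BernsteinSimplex.leadingMSE F x n t) ∧
      -- the asymptotically optimal choices of `m` are exactly those equivalent to `mOpt`
      (∀ m : ℕ → ℕ,
        BernsteinSimplex.IsAsymptoticallyOptimal (BernsteinSimplex.mse P X F x)
            (fun n : ℕ => (n : ℝ) ^ (-(4 / 3) : ℝ)) m ↔
          (fun n : ℕ => (m n : ℝ)) ~[atTop] BernsteinSimplex.mOpt F x) ∧
      -- the mean squared error at the optimal choice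
      (∀ m : ℕ → ℕ, (fun n : ℕ => (m n : ℝ)) ~[atTop] BernsteinSimplex.mOpt F x →
        (fun n : ℕ => BernsteinSimplex.mse P X F x n (m n) -
            ((n : ℝ)⁻¹ * BernsteinSimplex.sigmaSq F x
              - (n : ℝ) ^ (-(4 / 3) : ℝ) * (3 / 4) *
                (BernsteinSimplex.varCoeff F x ^ 4 /
                  (4 * BernsteinSimplex.biasCoeff F x ^ 2)) ^ (1 / 3 : ℝ)))
          =o[atTop] fun n : ℕ => (n : ℝ) ^ (-(4 / 3) : ℝ))) := by

  refine ⟨fun m hm => BernsteinSimplex.exists_mse_remainders hlaw hindep hF hC2 hm,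
    fun x hx hVB => ?_⟩
  have hB : BernsteinSimplex.biasCoeff F x ≠ 0 := right_ne_zero_of_mul hVB
  have hV : 0 < BernsteinSimplex.varCoeff F x :=
    (BernsteinSimplex.varCoeff_nonneg hF x).lt_of_ne' (left_ne_zero_of_mul hVB)
  exact ⟨fun n hn => ⟨BernsteinSimplex.mOpt_pos hV hB hn,
      fun t ht hne => BernsteinSimplex.leadingMSE_mOpt_lt hV hB hn ht hne⟩,
    BernsteinSimplex.isAsymptoticallyOptimal_iff hlaw hindep hF hC2 hx hV hB,
    fun m hm => BernsteinSimplex.isLittleO_mse_sub hlaw hindep hF hC2 hx hV hB hm⟩
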